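/- Let $\Sigma$ be a smooth surface immersed in $\mathbb{R}^3$ (in particular, it may be embedded; it need not be complete), that is, a Hausdorff, second countable smooth $2$-manifold without boundary together with a smooth immersion $F:\Sigma\to\mathbb{R}^3$, and let $o\in\Sigma$ be a point with $F(o)=0$, simply denoted $0$. Give $\Sigma$ the metric induced from $\mathbb{R}^3$. Let $\mathcal{B}_s=\{x\in\Sigma: \operatorname{dist}_\Sigma(0,x)<s\}$ be the intrinsic ball of radius $s$ centered at $0$, and let $\operatorname{inj}_\Sigma(0)$ be the injectivity radius, i.e. the supremum of all $r$ such that the exponential map at $0$ is defined on the open disk of radius $r$ in $T_0\Sigma$ and is a diffeomorphism from it onto its image. Let $\kappa_1,\kappa_2$ be the principal curvatures, $H=\kappa_1+\kappa_2$ the mean curvature and $|A|^2=\kappa_1^2+\kappa_2^2$ the squared norm of the second fundamental form. Integrals are with respect to the area measure of $\Sigma$ and take values in $[0,\infty]$ (with $0\cdot\infty=0$). Let $s>0$ with $\operatorname{inj}_\Sigma(0)\ge s$, let $p>2$ and let $q$ be such that $\frac1q+\frac2p=1$. Put $$\epsilon=\left(s^{p-2}\int_{\mathcal{B}_s}|H|^p\right)^{1/p}\in[0,\infty].$$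 Then $$\int_{\mathcal{B}_s}|H|^2\le \epsilon^2\left(s^{-2}\operatorname{Area}\mathcal{B}_s\right)^{1/q}$$ and $$\int_{\mathcal{B}_s}|H|^2\le 2^{p/2}\left(\epsilon^2+\epsilon^p\right)\left(\pi+\frac12\int_{\mathcal{B}_s}|A|^2\right)^{1/q}.$$ -/

import Mathlib

open MeasureTheory Set
open scoped Manifold ContDiff ENNReal NNReal Matrix InnerProductSpace

namespace ImmersedSurface

noncomputable section

/-- The Euclidean plane, on which surfaces are modelled. -/
abbrev Plane : Type := EuclideanSpace ℝ (Fin 2)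

/-- The ambient Euclidean space. -/
abbrev Space : Type := EuclideanSpace ℝ (Fin 3)

/-! ### Local parametrizations `X : ℝ² → ℝ³` -/

/-- The coordinate derivative `∂ᵢ X`. -/
def partialDeriv (X : Plane → Space) (i : Fin 2) (u : Plane) : Space :=
  fderiv ℝ X u (EuclideanSpace.single i 1)

/-- The first fundamental form `g i j = ⟪∂ᵢ X, ∂ⱼ X⟫`. -/
def firstForm (X : Plane → Space) (u : Plane) : Matrix (Fin 2) (Fin 2) ℝ :=
  Matrix.of fun i j => ⟪partialDeriv X i u, partialDeriv X j u⟫_ℝ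

/-- The cross product `∂₀ X × ∂₁ X`. -/
def normalVector (X : Plane → Space) (u : Plane) : Space :=
  WithLp.toLp 2 (WithLp.ofLp (partialDeriv X 0 u) ⨯₃ WithLp.ofLp (partialDeriv X 1 u))

/-- The unit normal `(∂₀ X × ∂₁ X) / |∂₀ X × ∂₁ X|`. -/
def unitNormal (X : Plane → Space) (u : Plane) : Space :=
  ‖normalVector X u‖⁻¹ • normalVector X u

/-- The second fundamental form `h i j = ⟪∂ᵢ ∂ⱼ X, n⟫`. -/
def secondForm (X : Plane → Space) (u : Plane) : Matrix (Fin 2) (Fin 2) ℝ :=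
  Matrix.of fun i j => ⟪partialDeriv (partialDeriv X j) i u, unitNormal X u⟫_ℝ

/-- The matrix `g⁻¹ h` of the shape operator, whose eigenvalues are the principal curvatures. -/
def shapeMatrix (X : Plane → Space) (u : Plane) : Matrix (Fin 2) (Fin 2) ℝ :=
  (firstForm X u)⁻¹ * secondForm X u

variable {M : Type*} [TopologicalSpace M] [ChartedSpace Plane M]

/-- The differential of `F` at `x`, a map from the tangent plane of the surface to `ℝ³`. The tangent
space `TangentSpace (𝓡 2) x` of Mathlib is by definition the model space `Plane`, and its elements
are written below as elements of `Plane`. -/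
def differential (F : M → Space) (x : M) : Plane →L[ℝ] Space :=
  mfderiv (𝓡 2) 𝓘(ℝ, Space) F x

/-- A smooth immersion into `ℝ³`: a smooth map all of whose differentials are injective. -/
structure IsSmoothImmersion (F : M → Space) : Prop where
  contMDiff : ContMDiff (𝓡 2) 𝓘(ℝ, Space) ∞ F
  injective_differential : ∀ x : M, Function.Injective (differential F x)

/-! ### Curvature -/

/-- The local parametrization of the surface `F` given by the preferred chart at `x`. -/
def localParam (F : M → Space) (x : M) : Plane → Space :=
  F ∘ (chartAt Plane x).symm

/-- The mean curvature `H = κ₁ + κ₂` (trace of the shape operator) at `x`, with respect to the unit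
normal determined by the preferred chart at `x`. Only `|H|`, which does not depend on the choice of
the normal, is used below. -/
def meanCurvature (F : M → Space) (x : M) : ℝ :=
  (shapeMatrix (localParam F x) (chartAt Plane x x)).trace

/-- The squared norm `|A|² = κ₁² + κ₂²` of the second fundamental form at `x`. In indices it is
`∑ gⁱᵏ gʲˡ hᵢⱼ hₖₗ`, the trace of the square of the shape operator. -/
def secondFormNormSq (F : M → Space) (x : M) : ℝ :=
  (shapeMatrix (localParam F x) (chartAt Plane x x) ^ 2).trace

/-! ### Area -/

/-- The area measure `√(det g) du` of the domain of the chart at `x`, extended by zero to `M`. -/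
def chartArea [MeasurableSpace M] (F : M → Space) (x : M) : Measure M :=
  ((volume.restrict (chartAt Plane x).target).withDensity fun u =>
    ENNReal.ofReal (Real.sqrt (firstForm (localParam F x) u).det)).map (chartAt Plane x).symm

/-- The area measure of the surface. The measures `chartArea F x` agree on the overlaps of the chart
domains; their supremum in the lattice of measures is, on a second countable surface, the measure
that restricts to each of them on the respective chart domain. -/
def area [MeasurableSpace M] (F : M → Space) : Measure M :=
  ⨆ x : M, chartArea F x

/-! ### Intrinsic distance, geodesics and injectivity radius -/

/-- The length `‖dF_x v‖` of a tangent vector, in the metric induced by `F`. -/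
def tangentNorm (F : M → Space) (x : M) (v : Plane) : ℝ :=
  ‖differential F x v‖

/-- The intrinsic distance: infimum of the lengths, in the metric induced by `F`, of `C¹` paths
in `M` joining two points (infinite when there is no such path). -/
def intrinsicDist (F : M → Space) (x y : M) : ℝ≥0∞ :=
  letI : ∀ z : M, ENorm (TangentSpace (𝓡 2) z) :=
    fun z => ⟨fun v => ENNReal.ofReal (tangentNorm F z v)⟩
  Manifold.riemannianEDist (𝓡 2) x y

/-- The open intrinsic ball of radius `s` centered at `o`. -/
def intrinsicBall (F : M → Space) (o : M) (s : ℝ) : Set M :=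
  {x | intrinsicDist F o x < ENNReal.ofReal s}

/-- `γ` is, on the open set `J` of times, a geodesic of the surface: the part of the acceleration of
`F ∘ γ` which is tangent to the surface vanishes. -/
def IsGeodesicOn (F : M → Space) (γ : ℝ → M) (J : Set ℝ) : Prop :=
  ContMDiffOn 𝓘(ℝ, ℝ) (𝓡 2) ∞ γ J ∧
    ∀ t ∈ J, ∀ w : Plane,
      ⟪deriv (deriv (F ∘ γ)) t, differential F (γ t) w⟫_ℝ = 0

/-- The open disk of radius `r` about `0` in the tangent space at `o`. -/
def tangentDisk (F : M → Space) (o : M) (r : ℝ) : Set Plane :=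
  {v | tangentNorm F o v < r}

/-- `e` is the exponential map at `o` on the open disk of radius `r` of the tangent plane at `o`:
`e 0 = o` and, for every `v` in the disk, `t ↦ e (t v)` is, as long as `t v` stays in the disk, the geodesic that
starts at `o` with velocity `v`. -/
def IsExpMapOn (F : M → Space) (o : M) (r : ℝ) (e : Plane → M) : Prop :=
  e 0 = o ∧ ∀ v ∈ tangentDisk F o r,
    HasMFDerivAt 𝓘(ℝ, ℝ) (𝓡 2) (fun t : ℝ => e (t • v)) 0
      (ContinuousLinearMap.toSpanSingleton ℝ v) ∧
    IsGeodesicOn F (fun t : ℝ => e (t • v)) {t : ℝ | t • v ∈ tangentDisk F o r}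

/-- The exponential map at `o` is defined on the open disk of radius `r` and is a diffeomorphism
from it onto its image, that is, an injective smooth map with invertible differentials. -/
def ExpIsDiffeoOn (F : M → Space) (o : M) (r : ℝ) : Prop :=
  ∃ e : Plane → M, IsExpMapOn F o r e ∧
    ContMDiffOn (𝓡 2) (𝓡 2) ∞ e (tangentDisk F o r) ∧
    InjOn e (tangentDisk F o r) ∧
    ∀ v ∈ tangentDisk F o r, Function.Bijective (mfderiv (𝓡 2) (𝓡 2) e v)

/-- The injectivity radius at `o`: the supremum of the radii of the disks on which the exponential
map is defined and is a diffeomorphism onto its image. -/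
def injRadius (F : M → Space) (o : M) : ℝ≥0∞ :=
  ⨆ (r : ℝ≥0) (_ : ExpIsDiffeoOn F o r), (r : ℝ≥0∞)

end

end ImmersedSurface

/-! Both bounds are Hölder's inequality for `|H|² · 1` with the conjugate exponents `p/2` and `q`.
The power of `s` in `ε` is chosen so that the area appears only as the scale-invariant ratio `s⁻²
Area`, and the first bound is then immediate. The second follows from the area estimate `Area 𝓑_s ≤
s² (π + ½ ∫ |A|²)` (`area_intrinsicBall_le`); its factor `2^(p/2) ≥ 1` and its summand `ε^p` are
slack.

The area estimate is a comparison in geodesic polar coordinates. Along a radial geodesic the polar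
area density `J` satisfies `J'' = -K J`, `J(0) = 0`, `J'(0) = 1` (`jacobi_equation`). Hence `J' ≤ 1
+ ∫ K⁻ J` and `J(t) ≤ t (1 + ∫ K⁻ J)`. Integrating over `t < ρ` and over all directions gives `Area
≤ ρ² (π + ½ ∫ K⁻)`, and `K⁻ ≤ |A|²` because `|A|² + 2K = H²`.

Everything is computed extrinsically for `X = F ∘ exp`, written in orthonormal coordinates of the
tangent plane (`IsNormalParam`). Being geodesic means that `D²X_u(u, u)` is normal to the surface.
One transverse derivative of this identity, together with the Gauss lemma, yields the Jacobi
equation. The Gauss lemma also identifies `𝓑_ρ` with the image of the round disk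
(`intrinsicBall_subset_image_ball`). Finally `gaussCurvature_comp` and `area_restrict_target` show
that curvature and area, defined through charts, may be computed in the exponential parametrization.
-/

/-! ### Hölder's inequality and scaling -/

theorem lintegral_sq_le_rpow_mul_rpow {α : Type*} [MeasurableSpace α] (μ : Measure α)
    (f : α → ℝ≥0∞) {p q : ℝ} (hp : 2 < p) (hpq : 1 / q + 2 / p = 1) :
    ∫⁻ x, f x ^ 2 ∂μ ≤ (∫⁻ x, f x ^ p ∂μ) ^ (2 / p) * μ univ ^ (1 / q) := by
  -- `f` need not be measurable: the lower integral of `f²` is attained by a measurable `g ≤ f²`,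
  -- and Hölder is applied to `g · 1`.
  obtain ⟨g, hg, hgf, hfg⟩ := exists_measurable_le_lintegral_eq μ (fun x => f x ^ 2)
  have hp0 : 0 < p := by linarith
  have hq0 : 0 < q := by
    have h1 : 2 / p < 1 := by rw [div_lt_one hp0]; exact hp
    exact one_div_pos.1 (by linarith)
  have hc : (p / 2).HolderConjugate q := by
    rw [Real.holderConjugate_iff]
    refine ⟨by linarith, ?_⟩
    rw [inv_div, ← one_div q]; linarith
  have h := ENNReal.lintegral_mul_le_Lp_mul_Lq μ hc hg.aemeasurable
    (aemeasurable_const (b := (1 : ℝ≥0∞)))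
  rw [hfg]
  simp only [Pi.mul_apply, mul_one, ENNReal.one_rpow, lintegral_const, one_mul, one_div,
    inv_div] at h ⊢
  refine h.trans ?_
  gcongr with x
  calc g x ^ (p / 2) ≤ (f x ^ 2) ^ (p / 2) := by gcongr; exact hgf x
    _ = f x ^ p := by
        rw [← ENNReal.rpow_natCast, ← ENNReal.rpow_mul]; congr 1; push_cast; ring

/-- The two `L²` bounds, from Hölder's inequality and a bound `μ(univ) ≤ s² (π + a)`. -/
theorem lintegral_sq_le_of_measure_le {α : Type*} [MeasurableSpace α] (μ : Measure α)
    (f : α → ℝ≥0∞) {s : ℝ} (hs : 0 < s) {p q : ℝ} (hp : 2 < p) (hpq : 1 / q + 2 / p = 1)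
    {ε : ℝ≥0∞} (hε : (ENNReal.ofReal s ^ (p - 2) * ∫⁻ x, f x ^ p ∂μ) ^ (1 / p) = ε) :
    (∫⁻ x, f x ^ 2 ∂μ ≤ ε ^ 2 * (ENNReal.ofReal (s ^ (-2 : ℤ)) * μ univ) ^ (1 / q)) ∧
    ∀ a : ℝ≥0∞, μ univ ≤ ENNReal.ofReal (s ^ 2) * a →
      ∫⁻ x, f x ^ 2 ∂μ ≤ ENNReal.ofReal ((2 : ℝ) ^ (p / 2)) * (ε ^ 2 + ε ^ p) * a ^ (1 / q) := by
  have hp0 : 0 < p := by linarith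
  have hq0 : 0 < 1 / q := by
    have h1 : 2 / p < 1 := by rw [div_lt_one hp0]; exact hp
    linarith
  have hs0 : ENNReal.ofReal s ≠ 0 := by simpa using hs
  have key : ∫⁻ x, f x ^ 2 ∂μ ≤
      ε ^ 2 * (ENNReal.ofReal (s ^ (-2 : ℤ)) * μ univ) ^ (1 / q) := by
    refine (lintegral_sq_le_rpow_mul_rpow μ f hp hpq).trans (le_of_eq ?_)
    -- The exponent is `(p - 2) · 2/p = 2 (1 - 2/p) = 2/q`, which cancels the `s^(-2/q)` coming from
    -- the normalized area.
    have e1 : ε ^ 2 = ENNReal.ofReal s ^ (2 * (1 / q)) * (∫⁻ x, f x ^ p ∂μ) ^ (2 / p) := by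
      rw [← hε, ← ENNReal.rpow_natCast, ← ENNReal.rpow_mul,
        ENNReal.mul_rpow_of_nonneg _ _ (by positivity), ← ENNReal.rpow_mul]
      have : 1 / q = 1 - 2 / p := by linarith
      rw [this]
      congr 2
      · push_cast; field_simp
      · push_cast; ring
    have e2 : ENNReal.ofReal (s ^ (-2 : ℤ)) = ENNReal.ofReal s ^ (-2 : ℝ) := by
      rw [ENNReal.ofReal_rpow_of_pos hs]
      congr 1
      rw [← Real.rpow_intCast]; norm_num
    rw [e1, e2, ENNReal.mul_rpow_of_nonneg _ _ hq0.le, ← ENNReal.rpow_mul]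
    have e3 : ENNReal.ofReal s ^ (2 * (1 / q)) * ENNReal.ofReal s ^ (-2 * (1 / q)) = 1 := by
      rw [← ENNReal.rpow_add _ _ hs0 ENNReal.ofReal_ne_top]; simp
    rw [mul_mul_mul_comm, e3, one_mul]
  refine ⟨key, fun a ha => key.trans ?_⟩
  have h1 : ENNReal.ofReal (s ^ (-2 : ℤ)) * μ univ ≤ a := by
    calc _ ≤ ENNReal.ofReal (s ^ (-2 : ℤ)) * (ENNReal.ofReal (s ^ 2) * a) := by gcongr
      _ = a := by
        rw [← mul_assoc, ← ENNReal.ofReal_mul (by positivity)]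
        have : s ^ (-2 : ℤ) * s ^ 2 = 1 := by field_simp
        rw [this]; simp
  gcongr
  -- The constant is only used as a number at least `1`, and `ε ^ p` is dropped.
  have h2 : (1 : ℝ≥0∞) ≤ ENNReal.ofReal ((2 : ℝ) ^ (p / 2)) := by
    rw [ENNReal.one_le_ofReal]
    exact Real.one_le_rpow (by norm_num) (by positivity)
  calc ε ^ 2 = 1 * (ε ^ 2 + 0) := by simp
    _ ≤ _ := by gcongr; simp

namespace ImmersedSurface

noncomputable section

/-! ### The cross product of `ℝ³` -/

/-- The cross product on Euclidean space. -/
def cross (x y : Space) : Space := WithLp.toLp 2 (WithLp.ofLp x ⨯₃ WithLp.ofLp y)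

theorem inner_space_eq (x y : Space) : ⟪x, y⟫_ℝ = x 0 * y 0 + x 1 * y 1 + x 2 * y 2 := by
  simp [PiLp.inner_apply, Fin.sum_univ_three, mul_comm]

theorem cross_apply_zero (x y : Space) : cross x y 0 = x 1 * y 2 - x 2 * y 1 := by
  simp [cross, cross_apply]

theorem cross_apply_one (x y : Space) : cross x y 1 = x 2 * y 0 - x 0 * y 2 := by
  simp [cross, cross_apply]

theorem cross_apply_two (x y : Space) : cross x y 2 = x 0 * y 1 - x 1 * y 0 := by
  simp [cross, cross_apply]

theorem cross_linear_combination (x y : Space) (a b c d : ℝ) :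
    cross (a • x + b • y) (c • x + d • y) = (a * d - b * c) • cross x y := by
  ext i
  fin_cases i <;> simp [cross_apply_zero, cross_apply_one, cross_apply_two] <;> ring

theorem inner_left_cross (x y : Space) : ⟪x, cross x y⟫_ℝ = 0 := by
  rw [inner_space_eq, cross_apply_zero, cross_apply_one, cross_apply_two]; ring

theorem inner_right_cross (x y : Space) : ⟪y, cross x y⟫_ℝ = 0 := by
  rw [inner_space_eq, cross_apply_zero, cross_apply_one, cross_apply_two]; ring

/-- The polarized Gram determinant of three vectors. -/
theorem inner_cross_mul_inner_cross (a b x y : Space) :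
    ⟪a, cross x y⟫_ℝ * ⟪b, cross x y⟫_ℝ =
      ⟪a, b⟫_ℝ * (⟪x, x⟫_ℝ * ⟪y, y⟫_ℝ - ⟪x, y⟫_ℝ ^ 2)
      - ⟪a, x⟫_ℝ * (⟪b, x⟫_ℝ * ⟪y, y⟫_ℝ - ⟪x, y⟫_ℝ * ⟪b, y⟫_ℝ)
      + ⟪a, y⟫_ℝ * (⟪b, x⟫_ℝ * ⟪x, y⟫_ℝ - ⟪x, x⟫_ℝ * ⟪b, y⟫_ℝ) := by
  simp only [inner_space_eq, cross_apply_zero, cross_apply_one, cross_apply_two]; ring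

theorem inner_cross_self (x y : Space) :
    ⟪cross x y, cross x y⟫_ℝ = ⟪x, x⟫_ℝ * ⟪y, y⟫_ℝ - ⟪x, y⟫_ℝ ^ 2 := by
  simp only [inner_space_eq, cross_apply_zero, cross_apply_one, cross_apply_two]; ring

theorem continuous_cross : Continuous fun p : Space × Space => cross p.1 p.2 := by
  refine (PiLp.continuous_toLp 2 _).comp (continuous_pi fun i => ?_)
  fin_cases i <;> simp [cross_apply] <;> fun_prop

/-! ### Linear maps of the plane -/

/-- The standard basis of the plane. -/
abbrev stdVec (i : Fin 2) : Plane := EuclideanSpace.single i 1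

theorem plane_eq (v : Plane) : v = v 0 • stdVec 0 + v 1 • stdVec 1 := by
  ext i; fin_cases i <;> simp

theorem det_plane (P : Plane →L[ℝ] Plane) :
    P.det = P (stdVec 0) 0 * P (stdVec 1) 1 - P (stdVec 0) 1 * P (stdVec 1) 0 := by
  have h := LinearMap.det_toMatrix (EuclideanSpace.basisFun (Fin 2) ℝ).toBasis (P : Plane →ₗ[ℝ] Plane)
  rw [ContinuousLinearMap.det, ← h, Matrix.det_fin_two]
  simp [LinearMap.toMatrix_apply]
  ring

theorem cross_comp (A : Plane →L[ℝ] Space) (v w : Plane) :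
    cross (A v) (A w) = (v 0 * w 1 - v 1 * w 0) • cross (A (stdVec 0)) (A (stdVec 1)) := by
  conv_lhs => rw [plane_eq v, plane_eq w]
  simp only [map_add, map_smul]
  exact cross_linear_combination _ _ _ _ _ _

/-- By Lagrange's identity a vanishing cross product means equality in Cauchy–Schwarz, and the
resulting linear relation between the two columns contradicts injectivity. -/
theorem cross_ne_zero (A : Plane →L[ℝ] Space) (hA : Function.Injective A) :
    cross (A (stdVec 0)) (A (stdVec 1)) ≠ 0 := by
  intro h
  set x := A (stdVec 0)
  set y := A (stdVec 1)
  have h1 : ⟪x, x⟫_ℝ * ⟪y, y⟫_ℝ - ⟪x, y⟫_ℝ ^ 2 = 0 := by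
    rw [← inner_cross_self, h, inner_zero_left]
  have h2 : ⟪x, x⟫_ℝ • y - ⟪x, y⟫_ℝ • x = 0 := by
    rw [← inner_self_eq_zero (𝕜 := ℝ)]
    simp only [inner_sub_left, inner_sub_right, inner_smul_left, inner_smul_right,
      real_inner_comm x y, RCLike.conj_to_real]
    linear_combination ⟪x, x⟫_ℝ * h1
  have h3 : A (⟪x, x⟫_ℝ • stdVec 1 - ⟪x, y⟫_ℝ • stdVec 0) = A 0 := by
    simpa [x, y] using h2
  have h4 := congrArg (fun v : Plane => v 1) (hA h3)
  have h5 : ⟪x, x⟫_ℝ = 0 := by simpa using h4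
  have h6 : A (stdVec 0) = A 0 := by rw [map_zero]; exact inner_self_eq_zero.1 h5
  have h7 := congrArg (fun v : Plane => v 0) (hA h6)
  simp at h7

/-- The determinant of the values of a vector-valued bilinear form along a fixed vector. -/
def normalDet (B : Plane →L[ℝ] Plane →L[ℝ] Space) (n : Space) (v w : Plane) : ℝ :=
  ⟪B v v, n⟫_ℝ * ⟪B w w, n⟫_ℝ - ⟪B v w, n⟫_ℝ * ⟪B w v, n⟫_ℝ

/-- The scalar form `⟪B · ·, n⟫` changes by `Pᵀ b P`, so its determinant picks up `(det P)²`;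
symmetry of `B` plays no role. -/
theorem normalDet_eq (B : Plane →L[ℝ] Plane →L[ℝ] Space) (n : Space) (v w : Plane) :
    normalDet B n v w =
      (v 0 * w 1 - v 1 * w 0) ^ 2 * normalDet B n (stdVec 0) (stdVec 1) := by
  unfold normalDet
  have e : ∀ a b : Plane, ⟪B a b, n⟫_ℝ = a 0 * b 0 * ⟪B (stdVec 0) (stdVec 0), n⟫_ℝ
      + a 0 * b 1 * ⟪B (stdVec 0) (stdVec 1), n⟫_ℝ + a 1 * b 0 * ⟪B (stdVec 1) (stdVec 0), n⟫_ℝ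
      + a 1 * b 1 * ⟪B (stdVec 1) (stdVec 1), n⟫_ℝ := by
    intro a b
    conv_lhs => rw [plane_eq a, plane_eq b]
    simp only [map_add, map_smul, add_apply, smul_apply,
      inner_add_left, inner_smul_left, RCLike.conj_to_real]
    ring
  simp only [e v, e w]
  ring

/-! ### Gauss curvature of a parametrization -/

/-- The Gauss curvature, the determinant of the shape operator. -/
def gaussCurvature (X : Plane → Space) (u : Plane) : ℝ := (shapeMatrix X u).det

/-- For a `2 × 2` matrix, `tr S² + 2 det S = (tr S)² ≥ 0`. -/
theorem neg_two_mul_gaussCurvature_le (X : Plane → Space) (u : Plane) :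
    -2 * gaussCurvature X u ≤ (shapeMatrix X u ^ 2).trace := by
  unfold gaussCurvature
  generalize shapeMatrix X u = S
  rw [Matrix.det_fin_two, Matrix.trace_fin_two, pow_two]
  simp only [Matrix.mul_apply, Fin.sum_univ_two]
  nlinarith [sq_nonneg (S 0 0 + S 1 1)]

theorem normalVector_eq (X : Plane → Space) (u : Plane) :
    normalVector X u = cross (fderiv ℝ X u (stdVec 0)) (fderiv ℝ X u (stdVec 1)) := rfl

theorem det_firstForm (X : Plane → Space) (u : Plane) :
    (firstForm X u).det = ‖normalVector X u‖ ^ 2 := by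
  rw [← real_inner_self_eq_norm_sq, normalVector_eq, inner_cross_self, Matrix.det_fin_two]
  simp only [firstForm, Matrix.of_apply, partialDeriv]
  rw [real_inner_comm (fderiv ℝ X u (stdVec 0)) (fderiv ℝ X u (stdVec 1))]
  ring

theorem sqrt_det_firstForm (X : Plane → Space) (u : Plane) :
    Real.sqrt (firstForm X u).det = ‖normalVector X u‖ := by
  rw [det_firstForm, Real.sqrt_sq (norm_nonneg _)]

theorem partialDeriv_partialDeriv {X : Plane → Space} {u : Plane} (hX : ContDiffAt ℝ ∞ X u)
    (i j : Fin 2) :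
    partialDeriv (partialDeriv X j) i u = fderiv ℝ (fderiv ℝ X) u (stdVec i) (stdVec j) := by
  have h : DifferentiableAt ℝ (fderiv ℝ X) u :=
    (hX.fderiv_right (m := 1) (by norm_cast)).differentiableAt one_ne_zero
  unfold partialDeriv
  rw [fderiv_clm_apply h (differentiableAt_const _)]
  simp

/-- Here `K = det h / det g` with `det g = |N|²`, and normalizing `N` in `h` costs another `|N|²`.
Cleared of denominators, the right side is polynomial in the derivatives of `X`. -/
theorem gaussCurvature_mul {X : Plane → Space} {u : Plane} (hX : ContDiffAt ℝ ∞ X u)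
    (hN : normalVector X u ≠ 0) :
    gaussCurvature X u * ‖normalVector X u‖ ^ 4 =
      normalDet (fderiv ℝ (fderiv ℝ X) u) (normalVector X u) (stdVec 0) (stdVec 1) := by
  have h0 : ‖normalVector X u‖ ≠ 0 := norm_ne_zero_iff.2 hN
  rw [gaussCurvature, shapeMatrix, Matrix.det_mul, Matrix.det_nonsing_inv, det_firstForm,
    Ring.inverse_eq_inv', Matrix.det_fin_two]
  simp only [secondForm, Matrix.of_apply, unitNormal, partialDeriv_partialDeriv hX,
    inner_smul_right, normalDet]
  field_simp

theorem normalVector_comp {Y : Plane → Space} {φ : Plane → Plane} {u : Plane}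
    (hY : DifferentiableAt ℝ Y (φ u)) (hφ : DifferentiableAt ℝ φ u) :
    normalVector (Y ∘ φ) u = (fderiv ℝ φ u).det • normalVector Y (φ u) := by
  rw [normalVector_eq, normalVector_eq, fderiv_comp u hY hφ, det_plane,
    ContinuousLinearMap.comp_apply, ContinuousLinearMap.comp_apply, cross_comp]

theorem fderiv_fderiv_comp {Y : Plane → Space} {φ : Plane → Plane} {u : Plane}
    (hY : ContDiffAt ℝ ∞ Y (φ u)) (hφ : ContDiffAt ℝ ∞ φ u) (a b : Plane) :
    fderiv ℝ (fderiv ℝ (Y ∘ φ)) u a b =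
      fderiv ℝ (fderiv ℝ Y) (φ u) (fderiv ℝ φ u a) (fderiv ℝ φ u b) +
        fderiv ℝ Y (φ u) (fderiv ℝ (fderiv ℝ φ) u a b) := by
  have hY' : DifferentiableAt ℝ (fderiv ℝ Y) (φ u) :=
    (hY.fderiv_right (m := 1) (by norm_cast)).differentiableAt one_ne_zero
  have hφ' : DifferentiableAt ℝ (fderiv ℝ φ) u :=
    (hφ.fderiv_right (m := 1) (by norm_cast)).differentiableAt one_ne_zero
  have hφ1 : DifferentiableAt ℝ φ u := hφ.differentiableAt (by simp)
  have e : fderiv ℝ (Y ∘ φ) =ᶠ[nhds u] fun x => (fderiv ℝ Y (φ x)).comp (fderiv ℝ φ x) := by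
    have h1 : ∀ᶠ x in nhds u, DifferentiableAt ℝ φ x := by
      filter_upwards [(hφ.of_le (m := 1) (by norm_cast)).eventually (by simp)] with x hx
      exact hx.differentiableAt one_ne_zero
    have h2 : ∀ᶠ x in nhds (φ u), DifferentiableAt ℝ Y x := by
      filter_upwards [(hY.of_le (m := 1) (by norm_cast)).eventually (by simp)] with x hx
      exact hx.differentiableAt one_ne_zero
    filter_upwards [h1, hφ1.continuousAt.eventually h2] with x hx1 hx2
    exact fderiv_comp x hx2 hx1
  rw [e.fderiv_eq, fderiv_clm_comp (c := fun x => fderiv ℝ Y (φ x)) (hY'.comp u hφ1) hφ']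
  have e2 : fderiv ℝ (fun x => fderiv ℝ Y (φ x)) u =
      (fderiv ℝ (fderiv ℝ Y) (φ u)).comp (fderiv ℝ φ u) := fderiv_comp u hY' hφ1
  rw [e2]
  simp [add_comm]

/-- The Gauss curvature does not depend on the parametrization. -/
theorem gaussCurvature_comp {Y : Plane → Space} {φ : Plane → Plane} {u : Plane}
    (hY : ContDiffAt ℝ ∞ Y (φ u)) (hφ : ContDiffAt ℝ ∞ φ u)
    (hN : normalVector (Y ∘ φ) u ≠ 0) :
    gaussCurvature (Y ∘ φ) u = gaussCurvature Y (φ u) := by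
  have hc := normalVector_comp (hY.differentiableAt (by simp)) (hφ.differentiableAt (by simp))
  have hNY : normalVector Y (φ u) ≠ 0 := by
    intro h; rw [hc, h, smul_zero] at hN; exact hN rfl
  have h1 := gaussCurvature_mul (hY.comp u hφ) hN
  have h2 := gaussCurvature_mul hY hNY
  set d := (fderiv ℝ φ u).det
  -- The chain rule adds to the Hessian a tangential term, which `N` annihilates. The change of
  -- basis contributes `d²` and the two factors of `N` another `d²`, matching the scaling of `|N|⁴`.
  have h3 : normalDet (fderiv ℝ (fderiv ℝ (Y ∘ φ)) u) (normalVector (Y ∘ φ) u)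
      (stdVec 0) (stdVec 1) = d ^ 4 *
      normalDet (fderiv ℝ (fderiv ℝ Y) (φ u)) (normalVector Y (φ u)) (stdVec 0) (stdVec 1) := by
    have e : ∀ c : Plane, ⟪fderiv ℝ Y (φ u) c, normalVector Y (φ u)⟫_ℝ = 0 := by
      intro c
      rw [plane_eq c, map_add, map_smul, map_smul, inner_add_left, inner_smul_left,
        inner_smul_left, normalVector_eq, inner_left_cross, inner_right_cross]
      simp
    have h4 := normalDet_eq (fderiv ℝ (fderiv ℝ Y) (φ u)) (normalVector Y (φ u))
      (fderiv ℝ φ u (stdVec 0)) (fderiv ℝ φ u (stdVec 1))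
    rw [← det_plane] at h4
    rw [hc, normalDet]
    simp only [inner_smul_right, fderiv_fderiv_comp hY hφ, inner_add_left, e, add_zero]
    rw [normalDet] at h4
    linear_combination d ^ 2 * h4
  rw [h3, ← h2, hc, norm_smul, mul_pow, Real.norm_eq_abs, Even.pow_abs (by decide)] at h1
  have hd : d ≠ 0 := by
    intro h; rw [hc, h, zero_smul] at hN; exact hN rfl
  have h5 : ‖normalVector Y (φ u)‖ ≠ 0 := norm_ne_zero_iff.2 hNY
  have h6 : d ^ 4 * ‖normalVector Y (φ u)‖ ^ 4 ≠ 0 := by positivity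
  exact mul_right_cancel₀ h6 (by linear_combination h1)

end

end ImmersedSurface

namespace ImmersedSurface

noncomputable section

/-! ### One-dimensional comparison -/

/-- With `m` the integral of the positive part of `J''`, one has `J' ≤ 1 + m`, hence `J ≤ t (1 + m)`
by the mean value theorem; integrating `t` gives `ρ²/2`. No sign of `J` or `J''` is required. -/
theorem lintegral_le_of_hasDerivAt {J J₁ J₂ : ℝ → ℝ} {ρ : ℝ} (hρ : 0 < ρ)
    (h₁ : ∀ t ∈ Icc 0 ρ, HasDerivAt J (J₁ t) t) (h₂ : ∀ t ∈ Icc 0 ρ, HasDerivAt J₁ (J₂ t) t)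
    (hc : ContinuousOn J₂ (Icc 0 ρ)) (h0 : J 0 = 0) (h1 : J₁ 0 = 1) :
    ∫⁻ t in Ioo 0 ρ, ENNReal.ofReal (J t) ≤
      ENNReal.ofReal (ρ ^ 2 / 2) * (1 + ∫⁻ t in Ioo 0 ρ, ENNReal.ofReal (J₂ t)) := by
  have hcm : ContinuousOn (fun t => max (J₂ t) 0) (Icc 0 ρ) := hc.sup continuousOn_const
  set m : ℝ := ∫ t in (0 : ℝ)..ρ, max (J₂ t) 0
  have hm0 : 0 ≤ m := intervalIntegral.integral_nonneg hρ.le fun t _ => le_max_right _ _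
  have hm : ENNReal.ofReal m = ∫⁻ t in Ioo 0 ρ, ENNReal.ofReal (J₂ t) := by
    rw [show m = ∫ t in Ioc 0 ρ, max (J₂ t) 0 from intervalIntegral.integral_of_le hρ.le,
      integral_Ioc_eq_integral_Ioo, ofReal_integral_eq_lintegral_ofReal]
    · simp
    · exact (hcm.integrableOn_Icc).mono_set Ioo_subset_Icc_self
    · exact Filter.Eventually.of_forall fun t => le_max_right _ _
  have hJ₁ : ∀ t ∈ Icc 0 ρ, J₁ t ≤ 1 + m := by
    intro t ht
    have hsub : uIcc 0 t ⊆ Icc 0 ρ := by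
      rw [uIcc_of_le ht.1]; exact Icc_subset_Icc le_rfl ht.2
    have e := intervalIntegral.integral_eq_sub_of_hasDerivAt (a := 0) (b := t)
      (fun x hx => h₂ x (hsub hx)) (hc.mono hsub).intervalIntegrable
    have l1 : ∫ x in (0 : ℝ)..t, J₂ x ≤ ∫ x in (0 : ℝ)..t, max (J₂ x) 0 :=
      intervalIntegral.integral_mono_on ht.1 (hc.mono hsub).intervalIntegrable
        (hcm.mono hsub).intervalIntegrable fun x _ => le_max_left _ _
    have l2 : ∫ x in (0 : ℝ)..t, max (J₂ x) 0 ≤ m := by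
      refine intervalIntegral.integral_mono_interval le_rfl ht.1 ht.2
        (Filter.Eventually.of_forall fun x => le_max_right _ _) ?_
      exact ContinuousOn.intervalIntegrable (by rwa [uIcc_of_le hρ.le])
    linarith
  have hJ : ∀ t ∈ Ioo 0 ρ, J t ≤ t * (1 + m) := by
    intro t ht
    have hsub : Icc 0 t ⊆ Icc 0 ρ := Icc_subset_Icc le_rfl ht.2.le
    obtain ⟨c, hc, e⟩ := exists_hasDerivAt_eq_slope J J₁ ht.1
      (fun x hx => (h₁ x (hsub hx)).continuousAt.continuousWithinAt)
      (fun x hx => h₁ x (hsub (Ioo_subset_Icc_self hx)))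
    have := hJ₁ c (hsub (Ioo_subset_Icc_self hc))
    rw [e, h0, sub_zero, sub_zero, div_le_iff₀ ht.1] at this
    linarith
  calc ∫⁻ t in Ioo 0 ρ, ENNReal.ofReal (J t)
      ≤ ∫⁻ t in Ioo 0 ρ, ENNReal.ofReal (t * (1 + m)) :=
        setLIntegral_mono (by fun_prop) fun t ht => ENNReal.ofReal_le_ofReal (hJ t ht)
    _ = ENNReal.ofReal (ρ ^ 2 / 2 * (1 + m)) := by
        rw [← ofReal_integral_eq_lintegral_ofReal, ← integral_Ioc_eq_integral_Ioo,
          ← intervalIntegral.integral_of_le hρ.le, intervalIntegral.integral_mul_const, integral_id]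
        · simp
        · exact (Continuous.integrableOn_Icc (by fun_prop)).mono_set Ioo_subset_Icc_self
        · exact (ae_restrict_mem measurableSet_Ioo).mono fun t ht =>
            mul_nonneg ht.1.le (by linarith)
    _ = _ := by
        rw [ENNReal.ofReal_mul (by positivity), ENNReal.ofReal_add zero_le_one hm0, hm]; simp

/-! ### Geodesic normal parametrizations -/

/-- A parametrization of a disk for which the radial lines are geodesics and whose differential at
the origin is isometric. -/
structure IsNormalParam (X : Plane → Space) (r : ℝ) : Prop where
  contDiffOn : ContDiffOn ℝ ∞ X (Metric.ball 0 r)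
  injective : ∀ u ∈ Metric.ball (0 : Plane) r, Function.Injective (fderiv ℝ X u)
  norm_zero : ∀ v, ‖fderiv ℝ X 0 v‖ = ‖v‖
  geodesic : ∀ u ∈ Metric.ball (0 : Plane) r, ∀ w,
    ⟪fderiv ℝ (fderiv ℝ X) u u u, fderiv ℝ X u w⟫_ℝ = 0

theorem hasDerivAt_comp_smul {G : Type*} [NormedAddCommGroup G] [NormedSpace ℝ G] {f : Plane → G}
    {v : Plane} {t : ℝ} (hf : DifferentiableAt ℝ f (t • v)) :
    HasDerivAt (fun t : ℝ => f (t • v)) (fderiv ℝ f (t • v) v) t := by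
  have h := hf.hasFDerivAt.comp_hasDerivAt t ((hasDerivAt_id t).smul_const v)
  simpa [Function.comp_def] using h

theorem HasDerivAt.clm_const {G : Type*} [NormedAddCommGroup G] [NormedSpace ℝ G]
    {f : ℝ → Plane →L[ℝ] G} {f' : Plane →L[ℝ] G} {t : ℝ} (hf : HasDerivAt f f' t) (w : Plane) :
    HasDerivAt (fun t => f t w) (f' w) t := by
  simpa using hf.clm_apply (hasDerivAt_const t w)

/-! ### The Gauss lemma -/

namespace IsNormalParam

variable {X : Plane → Space} {r : ℝ} (hX : IsNormalParam X r)
include hX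

theorem contDiffAt {u : Plane} (hu : u ∈ Metric.ball (0 : Plane) r) : ContDiffAt ℝ ∞ X u :=
  hX.contDiffOn.contDiffAt (Metric.isOpen_ball.mem_nhds hu)

theorem contDiffAt_fderiv {u : Plane} (hu : u ∈ Metric.ball (0 : Plane) r) :
    ContDiffAt ℝ ∞ (fderiv ℝ X) u :=
  (hX.contDiffAt hu).fderiv_right (m := ∞) (by norm_cast)

theorem contDiffAt_fderiv_fderiv {u : Plane} (hu : u ∈ Metric.ball (0 : Plane) r) :
    ContDiffAt ℝ ∞ (fderiv ℝ (fderiv ℝ X)) u :=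
  (hX.contDiffAt_fderiv hu).fderiv_right (m := ∞) (by norm_cast)

theorem fderiv_fderiv_comm {u : Plane} (hu : u ∈ Metric.ball (0 : Plane) r) (a b : Plane) :
    fderiv ℝ (fderiv ℝ X) u a b = fderiv ℝ (fderiv ℝ X) u b a :=
  (hX.contDiffAt hu).isSymmSndFDerivAt
    (by rw [minSmoothness_of_isRCLikeNormedField]; exact ENat.LEInfty.out) a b

theorem hasDerivAt_fderiv {v : Plane} {t : ℝ} (hu : t • v ∈ Metric.ball (0 : Plane) r)
    (w : Plane) : HasDerivAt (fun t : ℝ => fderiv ℝ X (t • v) w)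
      (fderiv ℝ (fderiv ℝ X) (t • v) v w) t :=
  HasDerivAt.clm_const
    (hasDerivAt_comp_smul ((hX.contDiffAt_fderiv hu).differentiableAt (by simp))) w

/-- The geodesic condition at `u = t v` carries a factor `t²`; it says nothing at the origin, hence
`t ≠ 0`. -/
theorem geodesic_smul {v : Plane} {t : ℝ} (ht : t ≠ 0) (hu : t • v ∈ Metric.ball (0 : Plane) r)
    (w : Plane) : ⟪fderiv ℝ (fderiv ℝ X) (t • v) v v, fderiv ℝ X (t • v) w⟫_ℝ = 0 := by
  have h := hX.geodesic _ hu w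
  simp only [map_smul, smul_apply, inner_smul_left, RCLike.conj_to_real] at h
  rcases mul_eq_zero.1 h with h | h
  · exact absurd h ht
  rcases mul_eq_zero.1 h with h | h
  · exact absurd h ht
  · exact h

omit hX in
theorem smul_mem_ball {u : Plane} (hu : u ∈ Metric.ball (0 : Plane) r) {t : ℝ}
    (ht : t ∈ Icc (0 : ℝ) 1) : t • u ∈ Metric.ball (0 : Plane) r := by
  rw [mem_ball_zero_iff] at *
  rw [norm_smul, Real.norm_eq_abs, abs_of_nonneg ht.1]
  nlinarith [norm_nonneg u, ht.2]

/-- Geodesics have constant speed. The mean value theorem only asks for the derivative at an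
interior time, which avoids `t = 0`. -/
theorem inner_fderiv_self {u : Plane} (hu : u ∈ Metric.ball (0 : Plane) r) :
    ⟪fderiv ℝ X u u, fderiv ℝ X u u⟫_ℝ = ⟪u, u⟫_ℝ := by
  have hd : ∀ t ∈ Icc (0 : ℝ) 1, HasDerivAt
      (fun t : ℝ => ⟪fderiv ℝ X (t • u) u, fderiv ℝ X (t • u) u⟫_ℝ)
      (⟪fderiv ℝ X (t • u) u, fderiv ℝ (fderiv ℝ X) (t • u) u u⟫_ℝ +
        ⟪fderiv ℝ (fderiv ℝ X) (t • u) u u, fderiv ℝ X (t • u) u⟫_ℝ) t := fun t ht =>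
    (hX.hasDerivAt_fderiv (smul_mem_ball hu ht) u).inner ℝ
      (hX.hasDerivAt_fderiv (smul_mem_ball hu ht) u)
  obtain ⟨c, hc, e⟩ := exists_hasDerivAt_eq_slope _ _ zero_lt_one
    (fun t ht => (hd t ht).continuousAt.continuousWithinAt)
    (fun t ht => hd t (Ioo_subset_Icc_self ht))
  rw [real_inner_comm, hX.geodesic_smul hc.1.ne' (smul_mem_ball hu (Ioo_subset_Icc_self hc))] at e
  simp only [one_smul, zero_smul, add_zero, sub_zero, div_one] at e
  have h0 : ⟪fderiv ℝ X 0 u, fderiv ℝ X 0 u⟫_ℝ = ⟪u, u⟫_ℝ := by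
    rw [real_inner_self_eq_norm_sq, real_inner_self_eq_norm_sq, hX.norm_zero]
  linarith

/-- This is half the derivative, in direction `w`, of the identity `|dX_u u|² = |u|²`. -/
theorem inner_fderiv_add {u : Plane} (hu : u ∈ Metric.ball (0 : Plane) r) (w : Plane) :
    ⟪fderiv ℝ (fderiv ℝ X) u w u + fderiv ℝ X u w, fderiv ℝ X u u⟫_ℝ = ⟪w, u⟫_ℝ := by
  have h1 : HasFDerivAt (fun u => fderiv ℝ X u u) _ u :=
    (((hX.contDiffAt_fderiv hu).differentiableAt (by simp)).hasFDerivAt).clm_apply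
      (hasFDerivAt_id u)
  have h2 := (h1.inner ℝ h1).sub ((hasFDerivAt_id u).inner ℝ (hasFDerivAt_id u))
  have h3 : (fun u => ⟪fderiv ℝ X u u, fderiv ℝ X u u⟫_ℝ - ⟪u, u⟫_ℝ) =ᶠ[nhds u]
      fun _ => (0 : ℝ) := by
    filter_upwards [Metric.isOpen_ball.mem_nhds hu] with x hx
    rw [hX.inner_fderiv_self hx, sub_self]
  have h4 := (h2.congr_of_eventuallyEq h3.symm).unique (hasFDerivAt_const (0 : ℝ) u)
  have h5 := DFunLike.congr_fun h4 w
  simp at h5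
  rw [real_inner_comm u w, real_inner_comm (fderiv ℝ X u w + _) (fderiv ℝ X u u)] at h5
  rw [add_comm, real_inner_comm u w]
  linarith

/-- The Gauss lemma. -/
theorem inner_fderiv {u : Plane} (hu : u ∈ Metric.ball (0 : Plane) r) (w : Plane) :
    ⟪fderiv ℝ X u w, fderiv ℝ X u u⟫_ℝ = ⟪w, u⟫_ℝ := by
  -- The function `t ⟪dX_{tu} w, dX_{tu} u⟫` vanishes at `0`. Its derivative at `0 < t < 1` is `⟪w,
  -- u⟫`: the geodesic term drops out and `inner_fderiv_add` evaluates the rest.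
  have hd : ∀ t ∈ Icc (0 : ℝ) 1, HasDerivAt
      (fun t : ℝ => t * ⟪fderiv ℝ X (t • u) w, fderiv ℝ X (t • u) u⟫_ℝ)
      (1 * ⟪fderiv ℝ X (t • u) w, fderiv ℝ X (t • u) u⟫_ℝ +
        t * (⟪fderiv ℝ X (t • u) w, fderiv ℝ (fderiv ℝ X) (t • u) u u⟫_ℝ +
        ⟪fderiv ℝ (fderiv ℝ X) (t • u) u w, fderiv ℝ X (t • u) u⟫_ℝ)) t := fun t ht =>
    (hasDerivAt_id t).mul ((hX.hasDerivAt_fderiv (smul_mem_ball hu ht) w).inner ℝ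
      (hX.hasDerivAt_fderiv (smul_mem_ball hu ht) u))
  obtain ⟨c, hc, e⟩ := exists_hasDerivAt_eq_slope _ _ zero_lt_one
    (fun t ht => (hd t ht).continuousAt.continuousWithinAt)
    (fun t ht => hd t (Ioo_subset_Icc_self ht))
  have hcu := smul_mem_ball hu (Ioo_subset_Icc_self hc)
  rw [real_inner_comm (fderiv ℝ (fderiv ℝ X) (c • u) u u) (fderiv ℝ X (c • u) w),
    hX.geodesic_smul hc.1.ne' hcu, hX.fderiv_fderiv_comm hcu] at e
  have h := hX.inner_fderiv_add hcu w
  simp only [map_smul, inner_smul_right, inner_add_left, inner_smul_left,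
    RCLike.conj_to_real] at h
  have h' := mul_left_cancel₀ hc.1.ne' h
  simp only [one_smul, one_mul, zero_mul, sub_zero, div_one, zero_add] at e
  rw [← e, ← h', real_inner_comm (fderiv ℝ X (c • u) u) (fderiv ℝ X (c • u) w)]
  ring

/-- Gauss lemma plus Cauchy–Schwarz: the infinitesimal form of the radius being 1-Lipschitz for the
induced metric. -/
theorem abs_inner_le {u : Plane} (hu : u ∈ Metric.ball (0 : Plane) r) (w : Plane) :
    |⟪u, w⟫_ℝ| ≤ ‖u‖ * ‖fderiv ℝ X u w‖ := by
  have h0 : ‖fderiv ℝ X u u‖ = ‖u‖ := by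
    have := hX.inner_fderiv_self hu
    rw [real_inner_self_eq_norm_sq, real_inner_self_eq_norm_sq] at this
    exact (pow_left_inj₀ (norm_nonneg _) (norm_nonneg _) two_ne_zero).1 this
  rw [real_inner_comm, ← hX.inner_fderiv hu w, mul_comm, ← h0]
  exact abs_real_inner_le_norm _ _

end IsNormalParam

end

end ImmersedSurface

/-! ### The Jacobi equation in polar coordinates -/

namespace ImmersedSurface

noncomputable section

namespace IsNormalParam

variable {X : Plane → Space} {r : ℝ} (hX : IsNormalParam X r)
include hX

/-- The geodesic identity holds on an open set, so it can be differentiated in any direction `a`.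
The transverse direction supplies the second-order information needed for the Jacobi equation. -/
theorem inner_geodesic_deriv {u : Plane} (hu : u ∈ Metric.ball (0 : Plane) r) (a w : Plane) :
    ⟪fderiv ℝ (fderiv ℝ (fderiv ℝ X)) u a u u + (2 : ℝ) • fderiv ℝ (fderiv ℝ X) u a u,
      fderiv ℝ X u w⟫_ℝ + ⟪fderiv ℝ (fderiv ℝ X) u u u, fderiv ℝ (fderiv ℝ X) u a w⟫_ℝ = 0 := by
  have h1 := (((hX.contDiffAt_fderiv_fderiv hu).differentiableAt (by simp)).hasFDerivAt.clm_apply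
      (hasFDerivAt_id u)).clm_apply (hasFDerivAt_id u)
  have h2 := (((hX.contDiffAt_fderiv hu).differentiableAt (by simp)).hasFDerivAt).clm_apply
      (hasFDerivAt_const w u)
  have h3 : (fun u => ⟪fderiv ℝ (fderiv ℝ X) u u u, fderiv ℝ X u w⟫_ℝ) =ᶠ[nhds u]
      fun _ => (0 : ℝ) := by
    filter_upwards [Metric.isOpen_ball.mem_nhds hu] with x hx using hX.geodesic x hx w
  have h4 := ((h1.inner ℝ h2).congr_of_eventuallyEq h3.symm).unique (hasFDerivAt_const (0 : ℝ) u)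
  have h5 := DFunLike.congr_fun h4 a
  simp at h5
  rw [hX.fderiv_fderiv_comm hu u a] at h5
  rw [← h5, two_smul, add_comm]
  congr 2
  abel

/-- Symmetry of third derivatives: it turns the transverse derivative of the radial acceleration
into the second radial derivative of the variation field. -/
theorem third_fderiv_rotate {u : Plane} (hu : u ∈ Metric.ball (0 : Plane) r) (a b : Plane) :
    fderiv ℝ (fderiv ℝ (fderiv ℝ X)) u a b b = fderiv ℝ (fderiv ℝ (fderiv ℝ X)) u b b a := by
  have h1 : fderiv ℝ (fderiv ℝ (fderiv ℝ X)) u a b = fderiv ℝ (fderiv ℝ (fderiv ℝ X)) u b a :=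
    (hX.contDiffAt_fderiv hu).isSymmSndFDerivAt
      (by rw [minSmoothness_of_isRCLikeNormedField]; exact ENat.LEInfty.out) a b
  have hd := ((hX.contDiffAt_fderiv_fderiv hu).differentiableAt (by simp)).hasFDerivAt
  have h2 := (hd.clm_apply (hasFDerivAt_const a u)).clm_apply (hasFDerivAt_const b u)
  have h3 := (hd.clm_apply (hasFDerivAt_const b u)).clm_apply (hasFDerivAt_const a u)
  have h4 : (fun u => fderiv ℝ (fderiv ℝ X) u a b) =ᶠ[nhds u]
      fun u => fderiv ℝ (fderiv ℝ X) u b a := by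
    filter_upwards [Metric.isOpen_ball.mem_nhds hu] with x hx using hX.fderiv_fderiv_comm hx a b
  have h5 := DFunLike.congr_fun (h2.unique (h3.congr_of_eventuallyEq h4)) b
  simp at h5
  rw [h1, h5]

omit hX in
theorem smul_mem_ball_of_mem_Ioo {v : Plane} (hv : ‖v‖ = 1) {t : ℝ} (ht : t ∈ Ioo (-r) r) :
    t • v ∈ Metric.ball (0 : Plane) r := by
  rw [mem_ball_zero_iff, norm_smul, hv, mul_one, Real.norm_eq_abs, abs_lt]
  exact ht

theorem inner_fderiv_unit {v : Plane} (hv : ‖v‖ = 1) {t : ℝ} (ht : t ∈ Ioo 0 r) (w : Plane) :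
    ⟪fderiv ℝ X (t • v) w, fderiv ℝ X (t • v) v⟫_ℝ = ⟪w, v⟫_ℝ := by
  have h := hX.inner_fderiv (smul_mem_ball_of_mem_Ioo hv ⟨by linarith [ht.1, ht.2], ht.2⟩) w
  rw [map_smul, inner_smul_right, inner_smul_right] at h
  exact mul_left_cancel₀ ht.1.ne' h

section Polar

variable {v w : Plane} (hv : ‖v‖ = 1) (hw : ‖w‖ = 1) (hvw : ⟪w, v⟫_ℝ = 0)
  (hdet : v 0 * w 1 - v 1 * w 0 = 1)
include hv hvw hdet

omit hX hv hvw in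
theorem normalVector_smul {t : ℝ} :
    normalVector X (t • v) = cross (fderiv ℝ X (t • v) v) (fderiv ℝ X (t • v) w) := by
  rw [cross_comp, hdet, one_smul, normalVector_eq]

theorem norm_normalVector_smul {t : ℝ} (ht : t ∈ Ioo 0 r) :
    ‖normalVector X (t • v)‖ = ‖fderiv ℝ X (t • v) w‖ := by
  rw [← pow_left_inj₀ (norm_nonneg _) (norm_nonneg _) two_ne_zero,
    ← real_inner_self_eq_norm_sq, ← real_inner_self_eq_norm_sq,
    normalVector_smul hdet, inner_cross_self, hX.inner_fderiv_unit hv ht,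
    real_inner_comm (fderiv ℝ X (t • v) w) (fderiv ℝ X (t • v) v),
    hX.inner_fderiv_unit hv ht, hvw, real_inner_self_eq_norm_sq, hv]
  ring

set_option maxHeartbeats 800000 in
/-- The Jacobi equation along a radial geodesic. -/
theorem jacobi_equation {J : ℝ → ℝ} (hJ : J = fun t => t * ‖fderiv ℝ X (t • v) w‖)
    (hJd : ContDiffOn ℝ ∞ J (Ioo (-r) r)) {t : ℝ} (ht : t ∈ Ioo 0 r) :
    deriv (deriv J) t =
      t * (-gaussCurvature X (t • v) * ‖normalVector X (t • v)‖) := by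
  have hsub : Ioo 0 r ⊆ Ioo (-r) r := fun x hx => ⟨by linarith [hx.1, hx.2], hx.2⟩
  have hball : ∀ x ∈ Ioo 0 r, x • v ∈ Metric.ball (0 : Plane) r := fun x hx =>
    smul_mem_ball_of_mem_Ioo hv (hsub hx)
  set Z : ℝ → Space := fun t => fderiv ℝ X (t • v) w with hZ
  set Z₁ : ℝ → Space := fun t => fderiv ℝ (fderiv ℝ X) (t • v) v w with hZ₁
  set Z₂ : ℝ → Space := fun t => fderiv ℝ (fderiv ℝ (fderiv ℝ X)) (t • v) v v w with hZ₂
  have dZ : ∀ x ∈ Ioo 0 r, HasDerivAt Z (Z₁ x) x := fun x hx =>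
    hX.hasDerivAt_fderiv (hball x hx) w
  have dZ₁ : ∀ x ∈ Ioo 0 r, HasDerivAt Z₁ (Z₂ x) x := fun x hx =>
    HasDerivAt.clm_const (HasDerivAt.clm_const (hasDerivAt_comp_smul
      ((hX.contDiffAt_fderiv_fderiv (hball x hx)).differentiableAt (by simp))) v) w
  have dW : ∀ x ∈ Ioo 0 r, HasDerivAt (fun t => t • Z t) (x • Z₁ x + (1 : ℝ) • Z x) x :=
    fun x hx => (hasDerivAt_id x).smul (dZ x hx)
  have dW₁ : HasDerivAt (fun x => x • Z₁ x + (1 : ℝ) • Z x)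
      (t • Z₂ t + (1 : ℝ) • Z₁ t + (1 : ℝ) • Z₁ t) t :=
    ((hasDerivAt_id t).smul (dZ₁ t ht)).add (by simpa using dZ t ht)
  have hJd' : ContDiffOn ℝ ∞ (deriv J) (Ioo (-r) r) :=
    ((contDiffOn_infty_iff_deriv_of_isOpen isOpen_Ioo).1 hJd).2
  have dJ : ∀ x ∈ Ioo 0 r, HasDerivAt J (deriv J x) x := fun x hx =>
    ((hJd.contDiffAt (isOpen_Ioo.mem_nhds (hsub hx))).differentiableAt (by simp)).hasDerivAt
  have dJ₁ : HasDerivAt (deriv J) (deriv (deriv J) t) t :=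
    ((hJd'.contDiffAt (isOpen_Ioo.mem_nhds (hsub ht))).differentiableAt (by simp)).hasDerivAt
  -- With the Jacobi field `W = t Z`, the norm is avoided by differentiating `J² = |W|²` twice: `J'²
  -- + J J'' = ⟪W, W''⟫ + |W'|²`.
  have e0 : ∀ x, J x * J x = ⟪x • Z x, x • Z x⟫_ℝ := by
    intro x
    rw [inner_smul_left, inner_smul_right, real_inner_self_eq_norm_sq, hJ]
    simp only [RCLike.conj_to_real]; ring
  have e1 : ∀ x ∈ Ioo 0 r, J x * deriv J x = ⟪x • Z x, x • Z₁ x + (1 : ℝ) • Z x⟫_ℝ := by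
    intro x hx
    have h1 := (dJ x hx).mul (dJ x hx)
    have h2 := (dW x hx).inner ℝ (dW x hx)
    have h3 := h1.unique (h2.congr_of_eventuallyEq (Filter.Eventually.of_forall e0))
    rw [real_inner_comm (x • Z x) (x • Z₁ x + (1 : ℝ) • Z x)] at h3
    linarith
  have e2 : deriv J t * deriv J t + J t * deriv (deriv J) t =
      ⟪t • Z t, t • Z₂ t + (1 : ℝ) • Z₁ t + (1 : ℝ) • Z₁ t⟫_ℝ +
        ⟪t • Z₁ t + (1 : ℝ) • Z t, t • Z₁ t + (1 : ℝ) • Z t⟫_ℝ := by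
    refine ((dJ t ht).mul dJ₁).unique (((dW t ht).inner ℝ dW₁).congr_of_eventuallyEq ?_)
    filter_upwards [isOpen_Ioo.mem_nhds ht] with x hx using e1 x hx
  have hb := hball t ht
  set x := fderiv ℝ X (t • v) v
  set N := normalVector X (t • v) with hN
  have hNc : N = cross x (Z t) := normalVector_smul hdet
  have hxx : ⟪x, x⟫_ℝ = 1 := by
    rw [hX.inner_fderiv_unit hv ht, real_inner_self_eq_norm_sq, hv, one_pow]
  have hxZ : ⟪x, Z t⟫_ℝ = 0 := by
    rw [real_inner_comm, hX.inner_fderiv_unit hv ht, hvw]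
  have hZ₁x : ⟪Z₁ t, x⟫_ℝ = 0 := by
    have h := hX.inner_fderiv_add hb w
    simp only [map_smul, inner_smul_right, hvw, mul_zero] at h
    have h' := (mul_eq_zero.1 h).resolve_left ht.1.ne'
    rw [inner_add_left, inner_smul_left, hX.inner_fderiv_unit hv ht, hvw, add_zero,
      hX.fderiv_fderiv_comm hb] at h'
    exact (mul_eq_zero.1 h').resolve_left (by simpa using ht.1.ne')
  set a := fderiv ℝ (fderiv ℝ X) (t • v) v v with ha
  set b := fderiv ℝ (fderiv ℝ X) (t • v) w w with hbdef
  have hax : ⟪a, x⟫_ℝ = 0 := hX.geodesic_smul ht.1.ne' hb v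
  have haZ : ⟪a, Z t⟫_ℝ = 0 := hX.geodesic_smul ht.1.ne' hb w
  -- The radial acceleration `a` is normal to the surface, so only normal components enter `⟪a, b⟫`.
  have habN : ⟪a, N⟫_ℝ * ⟪b, N⟫_ℝ = ⟪a, b⟫_ℝ * ⟪Z t, Z t⟫_ℝ := by
    rw [hNc, inner_cross_mul_inner_cross, hxx, hxZ, hax, haZ]; ring
  have hZN : ⟪Z t, N⟫_ℝ = 0 := by rw [hNc, inner_right_cross]
  -- `W'` has no component along the unit radial vector `x`; the Gram identity splits it into its
  -- parts along `Z` and `N`.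
  have hW₁ : (t * ⟪Z₁ t, N⟫_ℝ) ^ 2 = ⟪t • Z₁ t + (1 : ℝ) • Z t, t • Z₁ t + (1 : ℝ) • Z t⟫_ℝ *
      ⟪Z t, Z t⟫_ℝ - ⟪t • Z₁ t + (1 : ℝ) • Z t, Z t⟫_ℝ ^ 2 := by
    have h := inner_cross_mul_inner_cross (t • Z₁ t + (1 : ℝ) • Z t)
      (t • Z₁ t + (1 : ℝ) • Z t) x (Z t)
    have h0 : ⟪t • Z₁ t + (1 : ℝ) • Z t, N⟫_ℝ = t * ⟪Z₁ t, N⟫_ℝ := by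
      rw [inner_add_left, inner_smul_left, inner_smul_left, hZN]; simp
    rw [← hNc, h0, hxx, hxZ] at h
    have h1 : ⟪t • Z₁ t + (1 : ℝ) • Z t, x⟫_ℝ = 0 := by
      rw [inner_add_left, inner_smul_left, inner_smul_left, hZ₁x, real_inner_comm, hxZ]; simp
    rw [h1] at h
    linear_combination h
  have hW₂ : ⟪t • Z t, t • Z₂ t + (1 : ℝ) • Z₁ t + (1 : ℝ) • Z₁ t⟫_ℝ = -t ^ 2 * ⟪a, b⟫_ℝ := by
    have h := hX.inner_geodesic_deriv hb w w
    simp only [map_smul, smul_apply, hX.third_fderiv_rotate hb, hX.fderiv_fderiv_comm hb w v,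
      inner_add_left, inner_smul_left, RCLike.conj_to_real] at h
    simp only [inner_smul_left, inner_add_right, inner_smul_right, RCLike.conj_to_real, one_mul,
      real_inner_comm (Z₂ t) (Z t), real_inner_comm (Z₁ t) (Z t)]
    linear_combination h
  have hND : ⟪a, N⟫_ℝ * ⟪b, N⟫_ℝ - ⟪Z₁ t, N⟫_ℝ ^ 2 = gaussCurvature X (t • v) * ‖N‖ ^ 4 := by
    rw [gaussCurvature_mul (hX.contDiffAt hb) (cross_ne_zero _ (hX.injective _ hb))]
    have h := normalDet_eq (fderiv ℝ (fderiv ℝ X) (t • v)) N v w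
    rw [hdet, one_pow, one_mul] at h
    rw [← h, normalDet, hX.fderiv_fderiv_comm hb w v]
    ring
  have hnorm : ‖N‖ = ‖Z t‖ := hX.norm_normalVector_smul hv hvw hdet ht
  have hpos : 0 < ‖Z t‖ := by
    rw [← hnorm]; exact norm_pos_iff.2 (cross_ne_zero _ (hX.injective _ hb))
  have hZZ : ⟪Z t, Z t⟫_ℝ = ‖Z t‖ ^ 2 := real_inner_self_eq_norm_sq _
  have hJt : J t = t * ‖Z t‖ := by rw [hJ]
  have e1' := e1 t ht
  rw [inner_smul_left, real_inner_comm, RCLike.conj_to_real, hJt] at e1'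
  have e3 : ‖Z t‖ * deriv J t = ⟪t • Z₁ t + (1 : ℝ) • Z t, Z t⟫_ℝ :=
    mul_left_cancel₀ ht.1.ne' (by linear_combination e1')
  rw [hnorm] at hND ⊢
  rw [hW₂, hJt] at e2
  rw [hZZ] at hW₁ habN
  -- After multiplication by `t |Z|³`, the part of `W'` along `Z` cancels `J'²`. The normal parts
  -- left over form the determinant of the second fundamental form, which is `K |N|⁴` by `hND`.
  have h3 : t * ‖Z t‖ ^ 3 ≠ 0 := mul_ne_zero ht.1.ne' (by positivity)
  refine mul_left_cancel₀ h3 ?_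
  rw [← e3] at hW₁
  linear_combination ‖Z t‖ ^ 2 * e2 - hW₁ - t ^ 2 * hND + t ^ 2 * habN

include hw

/-- The bound for the area of a sector that results from the Jacobi equation. -/
theorem lintegral_radial_le {ρ : ℝ} (hρ : 0 < ρ) (hρr : ρ < r) :
    ∫⁻ t in Ioo 0 ρ, ENNReal.ofReal (t * ‖normalVector X (t • v)‖) ≤
      ENNReal.ofReal (ρ ^ 2 / 2) * (1 + ∫⁻ t in Ioo 0 ρ, ENNReal.ofReal
        (t * (-gaussCurvature X (t • v) * ‖normalVector X (t • v)‖))) := by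
  set J : ℝ → ℝ := fun t => t * ‖fderiv ℝ X (t • v) w‖ with hJ
  -- Injectivity of `dX` keeps the norm away from zero, so `t |Z|`, unlike `|t Z|`, is smooth across
  -- `t = 0`, where the initial conditions are read off.
  have hZd : ContDiffOn ℝ ∞ (fun t : ℝ => ‖fderiv ℝ X (t • v) w‖) (Ioo (-r) r) := by
    intro t ht
    have hb := smul_mem_ball_of_mem_Ioo hv ht
    refine (ContDiffAt.norm ℝ ?_ ?_).contDiffWithinAt
    · have h : ContDiffAt ℝ ∞ (fun t : ℝ => fderiv ℝ X (t • v)) t :=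
        (hX.contDiffAt_fderiv hb).comp t (contDiffAt_id.smul contDiffAt_const)
      exact h.clm_apply contDiffAt_const
    · intro h
      have h' := hX.injective _ hb (h.trans (map_zero _).symm)
      simp [h'] at hw
  have hJd : ContDiffOn ℝ ∞ J (Ioo (-r) r) := contDiffOn_id.mul hZd
  have hJd' : ContDiffOn ℝ ∞ (deriv J) (Ioo (-r) r) :=
    ((contDiffOn_infty_iff_deriv_of_isOpen isOpen_Ioo).1 hJd).2
  have hJd'' : ContDiffOn ℝ ∞ (deriv (deriv J)) (Ioo (-r) r) :=
    ((contDiffOn_infty_iff_deriv_of_isOpen isOpen_Ioo).1 hJd').2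
  have hsub : Icc 0 ρ ⊆ Ioo (-r) r := fun x hx => ⟨by linarith [hx.1], by linarith [hx.2]⟩
  have h0 : deriv J 0 = 1 := by
    have hm : (0 : ℝ) ∈ Ioo (-r) r := hsub ⟨le_rfl, hρ.le⟩
    have hd := ((hZd.contDiffAt (isOpen_Ioo.mem_nhds hm)).differentiableAt (by simp)).hasDerivAt
    have h := ((hasDerivAt_id (0 : ℝ)).mul hd).deriv
    have h' : deriv J 0 = _ := h
    rw [h']
    simp [hX.norm_zero, hw]
  have h := lintegral_le_of_hasDerivAt hρ
    (fun t ht => ((hJd.contDiffAt (isOpen_Ioo.mem_nhds (hsub ht))).differentiableAt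
      (by simp)).hasDerivAt)
    (fun t ht => ((hJd'.contDiffAt (isOpen_Ioo.mem_nhds (hsub ht))).differentiableAt
      (by simp)).hasDerivAt)
    (hJd''.continuousOn.mono hsub) (by simp [J]) h0
  have hsub' : ∀ t ∈ Ioo 0 ρ, t ∈ Ioo 0 r := fun t ht => ⟨ht.1, ht.2.trans hρr⟩
  rw [setLIntegral_congr_fun measurableSet_Ioo fun t ht => by
    rw [hX.norm_normalVector_smul hv hvw hdet (hsub' t ht)]]
  refine h.trans (le_of_eq ?_)
  congr 2
  exact setLIntegral_congr_fun measurableSet_Ioo fun t ht => by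
    rw [hX.jacobi_equation hv hvw hdet hJ hJd (hsub' t ht)]

end Polar

end IsNormalParam

end

end ImmersedSurface

namespace ImmersedSurface

noncomputable section

/-! ### Regularity of the curvature in a parametrization -/

theorem continuousOn_normalVector {X : Plane → Space} {U : Set Plane} (hU : IsOpen U)
    (hX : ContDiffOn ℝ ∞ X U) : ContinuousOn (normalVector X) U := by
  have h := hX.continuousOn_fderiv_of_isOpen hU (by simp)
  exact continuous_cross.comp_continuousOn
    ((h.clm_apply continuousOn_const).prodMk (h.clm_apply continuousOn_const))

/-- `gaussCurvature_mul` exhibits `K` as a quotient of continuous functions. -/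
theorem continuousOn_gaussCurvature {X : Plane → Space} {U : Set Plane} (hU : IsOpen U)
    (hX : ContDiffOn ℝ ∞ X U) (hN : ∀ u ∈ U, normalVector X u ≠ 0) :
    ContinuousOn (gaussCurvature X) U := by
  have h1 : ContDiffOn ℝ ∞ (fderiv ℝ X) U := hX.fderiv_of_isOpen hU (by norm_cast)
  have h2 := h1.continuousOn_fderiv_of_isOpen hU (by simp)
  have hn := continuousOn_normalVector hU hX
  have h3 : ∀ i j, ContinuousOn (fun u => ⟪fderiv ℝ (fderiv ℝ X) u (stdVec i) (stdVec j),
      normalVector X u⟫_ℝ) U := fun i j =>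
    ((h2.clm_apply continuousOn_const).clm_apply continuousOn_const).inner hn
  have h4 : ContinuousOn (fun u => normalDet (fderiv ℝ (fderiv ℝ X) u) (normalVector X u)
      (stdVec 0) (stdVec 1) / ‖normalVector X u‖ ^ 4) U :=
    (((h3 0 0).mul (h3 1 1)).sub ((h3 0 1).mul (h3 1 0))).div (hn.norm.pow 4)
      fun u hu => pow_ne_zero _ (norm_ne_zero_iff.2 (hN u hu))
  refine h4.congr fun u hu => ?_
  rw [eq_div_iff (pow_ne_zero _ (norm_ne_zero_iff.2 (hN u hu)))]
  exact gaussCurvature_mul (hX.contDiffAt (hU.mem_nhds hu)) (hN u hu)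

/-! ### Polar coordinates -/

/-- The unit vector of angle `θ`. -/
def polarVec (θ : ℝ) : Plane := !₂[Real.cos θ, Real.sin θ]

/-- The unit vector of angle `θ + π / 2`. -/
def polarVecPerp (θ : ℝ) : Plane := !₂[-Real.sin θ, Real.cos θ]

theorem norm_polarVec (θ : ℝ) : ‖polarVec θ‖ = 1 := by
  simp [polarVec, EuclideanSpace.norm_eq, Fin.sum_univ_two]

theorem norm_polarVecPerp (θ : ℝ) : ‖polarVecPerp θ‖ = 1 := by
  simp [polarVecPerp, EuclideanSpace.norm_eq, Fin.sum_univ_two]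

theorem inner_polarVecPerp (θ : ℝ) : ⟪polarVecPerp θ, polarVec θ⟫_ℝ = 0 := by
  simp [polarVec, polarVecPerp, PiLp.inner_apply, Fin.sum_univ_two]; ring

theorem det_polarVec (θ : ℝ) :
    polarVec θ 0 * polarVecPerp θ 1 - polarVec θ 1 * polarVecPerp θ 0 = 1 := by
  simp [polarVec, polarVecPerp]
  nlinarith [Real.sin_sq_add_cos_sq θ]

/-- The plane as a product. -/
def prodEquivPlane : ℝ × ℝ ≃ᵐ Plane :=
  MeasurableEquiv.finTwoArrow.symm.trans (MeasurableEquiv.toLp 2 (Fin 2 → ℝ))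

theorem prodEquivPlane_apply (p : ℝ × ℝ) : prodEquivPlane p = !₂[p.1, p.2] := rfl

theorem measurePreserving_prodEquivPlane : MeasurePreserving prodEquivPlane :=
  (PiLp.volume_preserving_toLp (Fin 2)).comp (volume_preserving_finTwoArrow ℝ).symm

theorem prodEquivPlane_polarCoord_symm (t θ : ℝ) :
    prodEquivPlane (polarCoord.symm (t, θ)) = t • polarVec θ := by
  rw [prodEquivPlane_apply]
  ext i
  fin_cases i <;> simp [polarVec]

theorem setLIntegral_ball_eq_polar {g : Plane → ℝ≥0∞} (hg : Measurable g) (ρ : ℝ) :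
    ∫⁻ u in Metric.ball 0 ρ, g u = ∫⁻ θ in Ioo (-Real.pi) Real.pi, ∫⁻ t in Ioo 0 ρ,
      ENNReal.ofReal t * g (t • polarVec θ) := by
  set G : Plane → ℝ≥0∞ := (Metric.ball 0 ρ).indicator g with hG
  have hGm : Measurable G := hg.indicator measurableSet_ball
  have hGp : Measurable fun p : ℝ × ℝ =>
      ENNReal.ofReal p.1 * G (prodEquivPlane (polarCoord.symm p)) :=
    (ENNReal.measurable_ofReal.comp measurable_fst).mul
      (hGm.comp (prodEquivPlane.measurable.comp continuous_polarCoord_symm.measurable))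
  rw [← lintegral_indicator measurableSet_ball,
    ← measurePreserving_prodEquivPlane.lintegral_comp_emb prodEquivPlane.measurableEmbedding,
    ← lintegral_comp_polarCoord_symm]
  simp only [smul_eq_mul]
  rw [polarCoord_target, Measure.volume_eq_prod, ← Measure.prod_restrict,
    lintegral_prod_symm _ hGp.aemeasurable]
  refine lintegral_congr fun θ => ?_
  have hI : Ioo 0 ρ = Iio ρ ∩ Ioi 0 := by ext; simp [and_comm]
  rw [hI, ← Measure.restrict_restrict measurableSet_Iio, ← lintegral_indicator measurableSet_Iio]
  refine setLIntegral_congr_fun measurableSet_Ioi fun t ht => ?_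
  simp only
  rw [prodEquivPlane_polarCoord_symm, hG]
  have ht0 : 0 < t := ht
  by_cases h : t < ρ
  · rw [indicator_of_mem (by
      rw [mem_ball_zero_iff, norm_smul, norm_polarVec, mul_one, Real.norm_eq_abs,
        abs_of_pos ht0]; exact h), indicator_of_mem (by exact h)]
  · rw [indicator_of_notMem (by
      rw [mem_ball_zero_iff, norm_smul, norm_polarVec, mul_one, Real.norm_eq_abs,
        abs_of_pos ht0]; exact h), indicator_of_notMem (by exact h), mul_zero]

theorem measurable_indicator_of_continuousOn {U : Set Plane} (hU : IsOpen U) {f : Plane → ℝ}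
    (hf : ContinuousOn f U) : Measurable (U.indicator fun u => ENNReal.ofReal (f u)) := by
  classical
  rw [← piecewise_eq_indicator]
  exact (ENNReal.continuous_ofReal.comp_continuousOn hf).measurable_piecewise
    continuousOn_const hU.measurableSet

/-- The area of a geodesic disk in terms of its curvature. -/
theorem IsNormalParam.lintegral_ball_le {X : Plane → Space} {r : ℝ} (hX : IsNormalParam X r)
    {ρ : ℝ} (hρ : 0 < ρ) (hρr : ρ < r) :
    ∫⁻ u in Metric.ball 0 ρ, ENNReal.ofReal ‖normalVector X u‖ ≤
      ENNReal.ofReal (ρ ^ 2) * (ENNReal.ofReal Real.pi + 1 / 2 *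
        ∫⁻ u in Metric.ball 0 ρ,
          ENNReal.ofReal (-gaussCurvature X u * ‖normalVector X u‖)) := by
  have hN : ∀ u ∈ Metric.ball (0 : Plane) r, normalVector X u ≠ 0 := fun u hu =>
    cross_ne_zero _ (hX.injective u hu)
  have hsub : Metric.ball (0 : Plane) ρ ⊆ Metric.ball 0 r := Metric.ball_subset_ball hρr.le
  have hNc := (continuousOn_normalVector Metric.isOpen_ball hX.contDiffOn).norm
  have hKc : ContinuousOn (fun u => -gaussCurvature X u * ‖normalVector X u‖)
      (Metric.ball 0 r) := (continuousOn_gaussCurvature Metric.isOpen_ball hX.contDiffOn hN).neg.mul hNc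
  have polar : ∀ f : Plane → ℝ, ContinuousOn f (Metric.ball 0 r) →
      ∫⁻ u in Metric.ball 0 ρ, ENNReal.ofReal (f u) =
      ∫⁻ θ in Ioo (-Real.pi) Real.pi, ∫⁻ t in Ioo 0 ρ,
        ENNReal.ofReal (t * f (t • polarVec θ)) := by
    intro f hf
    have h := setLIntegral_ball_eq_polar (measurable_indicator_of_continuousOn
      Metric.isOpen_ball hf) ρ
    refine (setLIntegral_congr_fun measurableSet_ball fun u hu =>
      (indicator_of_mem (hsub hu) fun u => ENNReal.ofReal (f u)).symm).trans (h.trans ?_)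
    refine lintegral_congr fun θ => setLIntegral_congr_fun measurableSet_Ioo fun t ht => ?_
    have hb : t • polarVec θ ∈ Metric.ball (0 : Plane) r :=
      IsNormalParam.smul_mem_ball_of_mem_Ioo (norm_polarVec θ)
        ⟨by linarith [ht.1, ht.2], ht.2.trans hρr⟩
    rw [indicator_of_mem hb, ENNReal.ofReal_mul ht.1.le]
  rw [polar _ hNc, polar _ hKc]
  set m : ℝ → ℝ≥0∞ := fun θ => ∫⁻ t in Ioo 0 ρ, ENNReal.ofReal
    (t * (-gaussCurvature X (t • polarVec θ) * ‖normalVector X (t • polarVec θ)‖))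
  -- The angles have total measure `2π`, so `ρ²/2 · (2π + ∫ K⁻) = ρ² (π + ½ ∫ K⁻)`.
  calc _ ≤ ∫⁻ θ in Ioo (-Real.pi) Real.pi, ENNReal.ofReal (ρ ^ 2 / 2) * (1 + m θ) :=
        lintegral_mono fun θ => hX.lintegral_radial_le (norm_polarVec θ) (norm_polarVecPerp θ)
          (inner_polarVecPerp θ) (det_polarVec θ) hρ hρr
    _ = ENNReal.ofReal (ρ ^ 2 / 2) *
          (ENNReal.ofReal (2 * Real.pi) + ∫⁻ θ in Ioo (-Real.pi) Real.pi, m θ) := by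
        rw [lintegral_const_mul' _ _ ENNReal.ofReal_ne_top, lintegral_add_left measurable_const]
        simp only [lintegral_const, one_mul, Measure.restrict_apply_univ, Real.volume_Ioo]
        congr 3; ring
    _ = _ := by
        rw [div_eq_mul_inv (ρ ^ 2), ENNReal.ofReal_mul (by positivity), mul_assoc]
        congr 1
        rw [mul_add, ← ENNReal.ofReal_mul (by positivity)]
        congr 2
        · ring
        · rw [ENNReal.ofReal_inv_of_pos two_pos]; simp

end

end ImmersedSurface

namespace ImmersedSurface

noncomputable section

variable {M : Type*} [TopologicalSpace M] [ChartedSpace Plane M]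

/-! ### Parametrizations of an immersed surface -/

/-- A diffeomorphism of an open subset of the plane onto an open subset of the surface. -/
structure IsSmoothParam (E : OpenPartialHomeomorph Plane M) : Prop where
  contMDiffOn : ContMDiffOn (𝓡 2) (𝓡 2) ∞ E E.source
  injective : ∀ u ∈ E.source, Function.Injective (mfderiv (𝓡 2) (𝓡 2) E u)

/-- The area measure of a parametrized piece of the surface. -/
def paramArea [MeasurableSpace M] (F : M → Space) (E : OpenPartialHomeomorph Plane M) :
    Measure M :=
  ((volume.restrict E.source).withDensity fun u =>
    ENNReal.ofReal ‖normalVector (F ∘ E) u‖).map E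

theorem chartArea_eq_paramArea [MeasurableSpace M] (F : M → Space) (x : M) :
    chartArea F x = paramArea F (chartAt Plane x).symm := by
  unfold chartArea paramArea
  simp only [sqrt_det_firstForm]
  rfl

/-! ### Derivatives and curvature in a smooth parametrization -/

section Smooth

variable [IsManifold (𝓡 2) ∞ M] {F : M → Space} (hF : IsSmoothImmersion F)
include hF

theorem contDiffOn_localParam (x : M) :
    ContDiffOn ℝ ∞ (localParam F x) (chartAt Plane x).target := by
  rw [← contMDiffOn_iff_contDiffOn]
  exact hF.contMDiff.comp_contMDiffOn contMDiffOn_chart_symm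

variable {E : OpenPartialHomeomorph Plane M} (hE : IsSmoothParam E)
include hE

omit [IsManifold (𝓡 2) ∞ M] in
theorem contDiffOn_comp_param : ContDiffOn ℝ ∞ (F ∘ E) E.source := by
  rw [← contMDiffOn_iff_contDiffOn]
  exact hF.contMDiff.comp_contMDiffOn hE.contMDiffOn

omit [IsManifold (𝓡 2) ∞ M] hF in
theorem mdifferentiableAt_param {u : Plane} (hu : u ∈ E.source) :
    MDifferentiableAt (𝓡 2) (𝓡 2) E u :=
  (hE.contMDiffOn.contMDiffAt (E.open_source.mem_nhds hu)).mdifferentiableAt (by simp)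

omit [IsManifold (𝓡 2) ∞ M] in
theorem fderiv_comp_param {u : Plane} (hu : u ∈ E.source) (v : Plane) :
    fderiv ℝ (F ∘ E) u v = differential F (E u) (mfderiv (𝓡 2) (𝓡 2) E u v) := by
  rw [← mfderiv_eq_fderiv, mfderiv_comp u
    (hF.contMDiff.contMDiffAt.mdifferentiableAt (by simp)) (mdifferentiableAt_param hE hu)]
  rfl

omit [IsManifold (𝓡 2) ∞ M] in
theorem injective_fderiv_comp_param {u : Plane} (hu : u ∈ E.source) :
    Function.Injective (fderiv ℝ (F ∘ E) u) := by
  have h : ⇑(fderiv ℝ (F ∘ E) u) = differential F (E u) ∘ mfderiv (𝓡 2) (𝓡 2) E u :=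
    funext fun v => fderiv_comp_param hF hE hu v
  rw [h]
  exact (hF.injective_differential _).comp (hE.injective u hu)

omit [IsManifold (𝓡 2) ∞ M] in
theorem normalVector_comp_param_ne_zero {u : Plane} (hu : u ∈ E.source) :
    normalVector (F ∘ E) u ≠ 0 :=
  cross_ne_zero _ (injective_fderiv_comp_param hF hE hu)

omit hF in
theorem contDiffAt_transition (x : M) {u : Plane} (hu : u ∈ E.source)
    (hx : E u ∈ (chartAt Plane x).source) : ContDiffAt ℝ ∞ (chartAt Plane x ∘ E) u := by
  rw [← contMDiffAt_iff_contDiffAt]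
  exact (contMDiffAt_of_mem_maximalAtlas (IsManifold.chart_mem_maximalAtlas x) hx).comp u
    (hE.contMDiffOn.contMDiffAt (E.open_source.mem_nhds hu))

omit [IsManifold (𝓡 2) ∞ M] hF hE in
theorem comp_param_eventuallyEq (x : M) {u : Plane} (hu : u ∈ E.source)
    (hx : E u ∈ (chartAt Plane x).source) :
    F ∘ E =ᶠ[nhds u] localParam F x ∘ (chartAt Plane x ∘ E) := by
  filter_upwards [(E.continuousAt hu).preimage_mem_nhds
    ((chartAt Plane x).open_source.mem_nhds hx)] with y hy
  simp only [Function.comp_apply, localParam]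
  rw [(chartAt Plane x).left_inv hy]

omit [IsManifold (𝓡 2) ∞ M] hF hE in
theorem normalVector_congr {X Y : Plane → Space} {u : Plane} (h : X =ᶠ[nhds u] Y) :
    normalVector X u = normalVector Y u := by
  rw [normalVector_eq, normalVector_eq, h.fderiv_eq]

omit [IsManifold (𝓡 2) ∞ M] hF hE in
theorem gaussCurvature_congr {X Y : Plane → Space} {u : Plane} (h : X =ᶠ[nhds u] Y) :
    gaussCurvature X u = gaussCurvature Y u := by
  have h1 : ∀ j, partialDeriv X j =ᶠ[nhds u] partialDeriv Y j := fun j => by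
    filter_upwards [h.fderiv (𝕜 := ℝ)] with x hx
    simp only [partialDeriv, hx]
  have h2 : firstForm X u = firstForm Y u := by
    simp only [firstForm, (h1 _).eq_of_nhds]
  have h3 : secondForm X u = secondForm Y u := by
    have h4 : ∀ i j, partialDeriv (partialDeriv X j) i u = partialDeriv (partialDeriv Y j) i u :=
      fun i j => by unfold partialDeriv at h1 ⊢; rw [(h1 j).fderiv_eq]
    simp only [secondForm, h4, unitNormal, normalVector_congr h]
  rw [gaussCurvature, gaussCurvature, shapeMatrix, shapeMatrix, h2, h3]

/-- `|A|²` is defined in the preferred chart, so `K` is first moved there by `gaussCurvature_comp`.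
Where `K ≤ 0`, `-K ≤ -2K ≤ |A|²`, giving away a factor `2`. -/
theorem neg_gaussCurvature_le {u : Plane} (hu : u ∈ E.source) :
    ENNReal.ofReal (-gaussCurvature (F ∘ E) u) ≤ ENNReal.ofReal (secondFormNormSq F (E u)) := by
  set x := E u with hxu
  have hx : E u ∈ (chartAt Plane x).source := mem_chart_source Plane x
  have hev := comp_param_eventuallyEq (F := F) x hu hx
  have hN := normalVector_comp_param_ne_zero hF hE hu
  rw [normalVector_congr hev] at hN
  have h1 : gaussCurvature (F ∘ E) u = gaussCurvature (localParam F x) (chartAt Plane x x) := by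
    rw [gaussCurvature_congr hev, gaussCurvature_comp _ (contDiffAt_transition hE x hu hx) hN]
    · rfl
    · exact (contDiffOn_localParam hF x).contDiffAt
        ((chartAt Plane x).open_target.mem_nhds ((chartAt Plane x).map_source hx))
  have h2 := neg_two_mul_gaussCurvature_le (localParam F x) (chartAt Plane x x)
  rw [h1, secondFormNormSq]
  rcases le_total 0 (gaussCurvature (localParam F x) (chartAt Plane x x)) with h | h
  · rw [ENNReal.ofReal_of_nonpos (by linarith)]; exact zero_le
  · exact ENNReal.ofReal_le_ofReal (by linarith)

end Smooth

/-! ### The area measure in a parametrization -/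

section Area

variable [MeasurableSpace M] [BorelSpace M]

omit [ChartedSpace Plane M] in
theorem aemeasurable_param (E : OpenPartialHomeomorph Plane M) (f : Plane → ℝ≥0∞) :
    AEMeasurable E ((volume.restrict E.source).withDensity f) :=
  (E.continuousOn.aemeasurable E.open_source.measurableSet).mono_ac
    (withDensity_absolutelyContinuous _ _)

omit [ChartedSpace Plane M] in
theorem paramArea_apply (F : M → Space) (E : OpenPartialHomeomorph Plane M) {A : Set M}
    (hA : MeasurableSet A) : paramArea F E A =
      ∫⁻ u in E ⁻¹' A ∩ E.source, ENNReal.ofReal ‖normalVector (F ∘ E) u‖ := by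
  rw [paramArea, Measure.map_apply_of_aemeasurable (aemeasurable_param E _) hA,
    withDensity_apply', Measure.restrict_restrict' E.open_source.measurableSet]

omit [ChartedSpace Plane M] in
theorem measurableSet_preimage_inter_source (E : OpenPartialHomeomorph Plane M) {A : Set M}
    (hA : MeasurableSet A) : MeasurableSet (E ⁻¹' A ∩ E.source) := by
  have h := (continuousOn_iff_continuous_domRestrict.1 E.continuousOn).measurable hA
  have h' := E.open_source.measurableSet.subtype_image h
  convert h' using 1
  ext u
  simp [and_comm]

variable [IsManifold (𝓡 2) ∞ M] {F : M → Space} (hF : IsSmoothImmersion F)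
  {E : OpenPartialHomeomorph Plane M} (hE : IsSmoothParam E)
include hF hE

/-- Change of variables along the transition map `c ∘ E`: its Jacobian is the factor by which the
normal vectors differ. -/
theorem chartArea_eq_paramArea_of_subset (x : M) {A : Set M} (hA : MeasurableSet A)
    (hAE : A ⊆ E.target) (hAx : A ⊆ (chartAt Plane x).source) :
    chartArea F x A = paramArea F E A := by
  rw [chartArea_eq_paramArea, paramArea_apply _ _ hA, paramArea_apply _ _ hA]
  set c := chartAt Plane x
  set S := E ⁻¹' A ∩ E.source
  have himg : c.symm ⁻¹' A ∩ c.symm.source = (c ∘ E) '' S := by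
    ext y
    constructor
    · rintro ⟨hy, hyt⟩
      refine ⟨E.symm (c.symm y), ⟨?_, E.map_target (hAE hy)⟩, ?_⟩
      · change E (E.symm (c.symm y)) ∈ A
        rw [E.right_inv (hAE hy)]; exact hy
      · simp only [Function.comp_apply]
        rw [E.right_inv (hAE hy), c.right_inv hyt]
    · rintro ⟨u, ⟨hu, hus⟩, rfl⟩
      refine ⟨?_, c.map_source (hAx hu)⟩
      change c.symm (c (E u)) ∈ A
      rw [c.left_inv (hAx hu)]; exact hu
  have hinj : InjOn (c ∘ E) S := fun a ha b hb hab =>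
    E.injOn ha.2 hb.2 (c.injOn (hAx ha.1) (hAx hb.1) hab)
  have hd : ∀ u ∈ S, HasFDerivWithinAt (c ∘ E) (fderiv ℝ (c ∘ E) u) S u := fun u hu =>
    ((contDiffAt_transition hE x hu.2 (hAx hu.1)).differentiableAt
      (by simp)).hasFDerivAt.hasFDerivWithinAt
  have hS := measurableSet_preimage_inter_source E hA
  rw [himg, lintegral_image_eq_lintegral_abs_det_fderiv_mul volume hS hd hinj]
  refine setLIntegral_congr_fun hS fun u hu => ?_
  have hd1 := (contDiffAt_transition hE x hu.2 (hAx hu.1)).differentiableAt (by simp)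
  have hd2 : DifferentiableAt ℝ (localParam F x) ((c ∘ E) u) :=
    ((contDiffOn_localParam hF x).contDiffAt
      (c.open_target.mem_nhds (c.map_source (hAx hu.1)))).differentiableAt (by simp)
  have h := normalVector_comp hd2 hd1
  rw [← normalVector_congr (comp_param_eventuallyEq x hu.2 (hAx hu.1))] at h
  change _ * ENNReal.ofReal ‖normalVector (localParam F x) ((c ∘ E) u)‖ = _
  rw [h, norm_smul, Real.norm_eq_abs, ENNReal.ofReal_mul (abs_nonneg _)]

/-- For `≤`, the parametrized area plus the area outside `E.target` is an upper bound of every chart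
area, hence of their supremum. For `≥`, countably many chart domains cover `M`, and on each of them
the parametrized area is a chart area. -/
theorem area_restrict_target [SecondCountableTopology M] :
    (area F).restrict E.target = paramArea F E := by
  have hcs : ∀ x : M, ∀ A, MeasurableSet A → chartArea F x A =
      chartArea F x (A ∩ (chartAt Plane x).source) := by
    intro x A hA
    have hA' := hA.inter (chartAt Plane x).open_source.measurableSet
    rw [chartArea_eq_paramArea, paramArea_apply _ _ hA, paramArea_apply _ _ hA']
    congr 2
    ext u
    simp only [mem_inter_iff, mem_preimage]
    exact ⟨fun h => ⟨⟨h.1, (chartAt Plane x).map_target h.2⟩, h.2⟩, fun h => ⟨h.1.1, h.2⟩⟩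
  have hET := E.open_target.measurableSet
  have hle : (area F).restrict E.target ≤ paramArea F E := by
    have h1 : area F ≤ paramArea F E + (area F).restrict E.targetᶜ := by
      refine iSup_le fun x => Measure.le_iff.2 fun A hA => ?_
      rw [← measure_inter_add_sdiff A hET, Measure.add_apply]
      refine add_le_add ?_ ?_
      · have hm := (hA.inter hET)
        rw [hcs x _ hm, chartArea_eq_paramArea_of_subset hF hE x
          (hm.inter (chartAt Plane x).open_source.measurableSet)
          (fun y hy => hy.1.2) (fun y hy => hy.2)]
        exact measure_mono fun y hy => hy.1.1
      · rw [Measure.restrict_apply hA]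
        exact (le_iSup (fun x => chartArea F x) x : chartArea F x ≤ area F) _
    refine (Measure.restrict_mono subset_rfl h1).trans ?_
    rw [Measure.restrict_add, Measure.restrict_restrict hET, inter_compl_self,
      Measure.restrict_empty, add_zero]
    exact Measure.restrict_le_self
  obtain ⟨s, hs, hcov⟩ := TopologicalSpace.countable_cover_nhds
    fun x : M => (chartAt Plane x).open_source.mem_nhds (mem_chart_source Plane x)
  refine Measure.ext_of_biUnion_eq_univ hs hcov fun x _ => le_antisymm ?_ ?_
  · exact Measure.restrict_mono subset_rfl hle
  · refine Measure.le_iff.2 fun A hA => ?_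
    have hm := hA.inter (chartAt Plane x).open_source.measurableSet
    rw [Measure.restrict_apply hA, Measure.restrict_apply hA, Measure.restrict_apply hm]
    have h2 : paramArea F E (A ∩ (chartAt Plane x).source) =
        paramArea F E (A ∩ (chartAt Plane x).source ∩ E.target) := by
      rw [paramArea_apply _ _ hm, paramArea_apply _ _ (hm.inter hET)]
      congr 2
      ext u
      simp only [mem_inter_iff, mem_preimage]
      exact ⟨fun h => ⟨⟨h.1, E.map_source h.2⟩, h.2⟩, fun h => ⟨h.1.1, h.2⟩⟩
    rw [h2, ← chartArea_eq_paramArea_of_subset hF hE x (hm.inter hET)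
      (fun y hy => hy.2) (fun y hy => hy.1.2)]
    exact (le_iSup (fun x => chartArea F x) x : chartArea F x ≤ area F) _

theorem setLIntegral_area_image [SecondCountableTopology M] {S : Set Plane} (hS : IsOpen S)
    (hSE : S ⊆ E.source) {h : Plane → ℝ≥0∞} (hh : ContinuousOn h E.source) :
    ∫⁻ x in E '' S, h (E.symm x) ∂(area F) =
      ∫⁻ u in S, h u * ENNReal.ofReal ‖normalVector (F ∘ E) u‖ := by
  have hopen : IsOpen (E '' S) := E.isOpen_image_of_subset_source hS hSE
  have hsub : E '' S ⊆ E.target := by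
    rintro _ ⟨u, hu, rfl⟩; exact E.map_source (hSE hu)
  have hset : E '' S = E '' S ∩ E.target := (inter_eq_left.2 hsub).symm
  have hm : AEMeasurable ((E '' S).indicator fun x => h (E.symm x))
      ((area F).restrict E.target) :=
    ((hh.comp E.continuousOn_symm fun x hx => E.map_target hx).aemeasurable
      E.open_target.measurableSet).indicator hopen.measurableSet
  have hN : AEMeasurable (fun u => ENNReal.ofReal ‖normalVector (F ∘ E) u‖)
      (volume.restrict E.source) :=
    (ENNReal.continuous_ofReal.comp_continuousOn (continuousOn_normalVector E.open_source
      (contDiffOn_comp_param hF hE)).norm).aemeasurable E.open_source.measurableSet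
  have h1 : ∫⁻ x in E '' S, h (E.symm x) ∂(area F) =
      ∫⁻ x, (E '' S).indicator (fun x => h (E.symm x)) x ∂(paramArea F E) := by
    rw [← area_restrict_target hF hE, lintegral_indicator hopen.measurableSet,
      Measure.restrict_restrict hopen.measurableSet, ← hset]
  rw [area_restrict_target hF hE] at hm
  rw [h1, paramArea, lintegral_map' hm (aemeasurable_param E _),
    lintegral_withDensity_eq_lintegral_mul_non_measurable₀ _ hN
      (Filter.Eventually.of_forall fun _ => ENNReal.ofReal_lt_top)]
  have hSi : S = S ∩ E.source := (inter_eq_left.2 hSE).symm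
  conv_rhs => rw [hSi, ← Measure.restrict_restrict hS.measurableSet,
    ← lintegral_indicator hS.measurableSet]
  refine setLIntegral_congr_fun E.open_source.measurableSet fun u hu => ?_
  simp only [Pi.mul_apply]
  by_cases hu' : u ∈ S
  · rw [indicator_of_mem hu', indicator_of_mem (mem_image_of_mem E hu'), E.left_inv hu, mul_comm]
  · rw [indicator_of_notMem hu', indicator_of_notMem, mul_zero]
    rintro ⟨v, hv, hvu⟩
    exact hu' (E.injOn (hSE hv) hu hvu ▸ hv)

end Area

end

end ImmersedSurface

namespace ImmersedSurface

noncomputable section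

variable {M : Type*} [TopologicalSpace M] [ChartedSpace Plane M]

/-! ### The inverse function theorem on the surface -/

theorem mfderiv_eq_fderiv_chart {e : Plane → M} {u : Plane}
    (he : MDifferentiableAt (𝓡 2) (𝓡 2) e u) :
    mfderiv (𝓡 2) (𝓡 2) e u = fderiv ℝ (chartAt Plane (e u) ∘ e) u := by
  rw [he.mfderiv]
  simp only [writtenInExtChartAt, extChartAt, mfld_simps, fderivWithin_univ, chartAt_self_eq]
  rfl

variable [IsManifold (𝓡 2) ∞ M]

theorem contDiffAt_chart_comp {e : Plane → M} {u : Plane} (he : ContMDiffAt (𝓡 2) (𝓡 2) ∞ e u) :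
    ContDiffAt ℝ ∞ (chartAt Plane (e u) ∘ e) u := by
  rw [← contMDiffAt_iff_contDiffAt]
  exact (contMDiffAt_of_mem_maximalAtlas (IsManifold.chart_mem_maximalAtlas _)
    (mem_chart_source Plane (e u))).comp u he

/-- Equal dimensions make the differential surjective, so the inverse function theorem applies in a
chart. -/
theorem map_nhds_eq_of_injective_mfderiv {e : Plane → M} {u : Plane}
    (he : ContMDiffAt (𝓡 2) (𝓡 2) ∞ e u) (hinj : Function.Injective (mfderiv (𝓡 2) (𝓡 2) e u)) :
    Filter.map e (nhds u) = nhds (e u) := by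
  have hd : MDifferentiableAt (𝓡 2) (𝓡 2) e u := he.mdifferentiableAt (by simp)
  rw [mfderiv_eq_fderiv_chart hd] at hinj
  set c := chartAt Plane (e u)
  have hs := (contDiffAt_chart_comp he).hasStrictFDerivAt (by simp)
  have hr : (fderiv ℝ (c ∘ e) u).range = ⊤ :=
    LinearMap.range_eq_top.2 (LinearMap.injective_iff_surjective.1 hinj)
  have h1 := hs.map_nhds_eq_of_surj hr
  have hcu : c (e u) ∈ c.target := c.map_source (mem_chart_source Plane (e u))
  have h2 : e =ᶠ[nhds u] c.symm ∘ (c ∘ e) := by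
    filter_upwards [he.continuousAt.preimage_mem_nhds
      (c.open_source.mem_nhds (mem_chart_source Plane (e u)))] with y hy
    exact (c.left_inv hy).symm
  rw [Filter.map_congr h2, ← Filter.map_map, h1]
  have h3 := c.symm.map_nhds_eq hcu
  rw [Function.comp_apply, h3, c.left_inv (mem_chart_source Plane (e u))]

/-- The parametrization given by an injective smooth map with injective differentials. -/
theorem exists_isSmoothParam {e : Plane → M} {U : Set Plane} (hU : IsOpen U)
    (he : ContMDiffOn (𝓡 2) (𝓡 2) ∞ e U) (hinj : InjOn e U)
    (hd : ∀ u ∈ U, Function.Injective (mfderiv (𝓡 2) (𝓡 2) e u)) :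
    ∃ E : OpenPartialHomeomorph Plane M, E.source = U ∧ ⇑E = e ∧ IsSmoothParam E := by
  have ho : IsOpenMap (U.domRestrict e) := by
    rw [isOpenMap_iff_nhds_le]
    intro u
    have h1 : Filter.map (U.domRestrict e) (nhds u) = Filter.map e (nhds (u : Plane)) := by
      rw [← map_nhds_subtype_coe_eq_nhds u.2 (hU.mem_nhds u.2), Filter.map_map]
      rfl
    rw [h1, map_nhds_eq_of_injective_mfderiv (he.contMDiffAt (hU.mem_nhds u.2)) (hd u u.2)]
    rfl
  let E := OpenPartialHomeomorph.ofContinuousOpenRestrict (hinj.toPartialEquiv e U)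
    he.continuousOn ho hU
  exact ⟨E, rfl, rfl, he, hd⟩

theorem contMDiffOn_param_symm {E : OpenPartialHomeomorph Plane M} (hE : IsSmoothParam E) :
    ContMDiffOn (𝓡 2) (𝓡 2) ∞ E.symm E.target := by
  intro x hx
  set u := E.symm x with hu
  have hus : u ∈ E.source := E.map_target hx
  have hEu : E u = x := E.right_inv hx
  have he := hE.contMDiffOn.contMDiffAt (E.open_source.mem_nhds hus)
  have hinj := hE.injective u hus
  rw [mfderiv_eq_fderiv_chart (he.mdifferentiableAt (by simp))] at hinj
  have hcd := contDiffAt_chart_comp he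
  rw [hEu] at hinj hcd
  set c := chartAt Plane x
  have hxc : x ∈ c.source := mem_chart_source Plane x
  let φ := E.trans c
  let D : Plane ≃L[ℝ] Plane := (LinearEquiv.ofInjectiveEndo
    (fderiv ℝ (c ∘ E) u : Plane →ₗ[ℝ] Plane) hinj).toContinuousLinearEquiv
  have hD : (D : Plane →L[ℝ] Plane) = fderiv ℝ (c ∘ E) u := by ext v; rfl
  have hφ : ContDiffAt ℝ ∞ φ.symm (c x) := by
    have hsym : φ.symm (c x) = u := by
      change E.symm (c.symm (c x)) = u
      rw [c.left_inv hxc]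
    refine φ.contDiffAt_symm (f₀' := D) ?_ ?_ ?_
    · rw [OpenPartialHomeomorph.trans_target]
      exact ⟨c.map_source hxc, by simpa [c.left_inv hxc] using hx⟩
    · rw [hsym, hD]
      exact (hcd.differentiableAt (by simp)).hasFDerivAt
    · rw [hsym]; exact hcd
  have h1 : ContMDiffAt (𝓡 2) (𝓡 2) ∞ (φ.symm ∘ c) x :=
    (contMDiffAt_iff_contDiffAt.2 hφ).comp x
      (contMDiffAt_of_mem_maximalAtlas (IsManifold.chart_mem_maximalAtlas x) hxc)
  refine (h1.congr_of_eventuallyEq ?_).contMDiffWithinAt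
  filter_upwards [c.open_source.mem_nhds hxc] with y hy
  change E.symm y = E.symm (c.symm (c y))
  rw [c.left_inv hy]

/-! ### The exponential map as a normal parametrization -/

/-- Orthonormal coordinates for the pulled-back inner product; applied to the differential of `F` at
`o`, they turn `tangentDisk` into a round disk. -/
theorem exists_linear_isometry_param (A : Plane →L[ℝ] Space) (hA : Function.Injective A) :
    ∃ L : Plane ≃L[ℝ] Plane, ∀ u, ‖A (L u)‖ = ‖u‖ := by
  let A' := LinearEquiv.ofInjective (A : Plane →ₗ[ℝ] Space) hA
  have hr : Module.finrank ℝ (LinearMap.range (A : Plane →ₗ[ℝ] Space)) = 2 := by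
    rw [← A'.finrank_eq]; simp
  let b := (stdOrthonormalBasis ℝ (LinearMap.range (A : Plane →ₗ[ℝ] Space))).reindex (finCongr hr)
  refine ⟨(b.repr.symm.toLinearEquiv.trans A'.symm).toContinuousLinearEquiv, fun u => ?_⟩
  have h : A (A'.symm (b.repr.symm u)) = (A' (A'.symm (b.repr.symm u)) : Space) := rfl
  change ‖A (A'.symm (b.repr.symm u))‖ = _
  rw [h, A'.apply_symm_apply]
  exact b.repr.symm.norm_map u

theorem deriv_deriv_comp_smul {X : Plane → Space} {u : Plane} (hX : ContDiffAt ℝ ∞ X u) :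
    deriv (deriv fun t : ℝ => X (t • u)) 1 = fderiv ℝ (fderiv ℝ X) u u u := by
  have hX' : DifferentiableAt ℝ (fderiv ℝ X) ((1 : ℝ) • u) := by
    rw [one_smul]
    exact (hX.fderiv_right (m := 1) (by norm_cast)).differentiableAt one_ne_zero
  have hc : Filter.Tendsto (fun t : ℝ => t • u) (nhds 1) (nhds u) := by
    have : ContinuousAt (fun t : ℝ => t • u) 1 := by fun_prop
    simpa [ContinuousAt] using this
  have h1 : deriv (fun t : ℝ => X (t • u)) =ᶠ[nhds 1] fun t => fderiv ℝ X (t • u) u := by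
    filter_upwards [hc.eventually ((hX.of_le (m := 1) (by norm_cast)).eventually (by simp))]
      with t ht
    exact (hasDerivAt_comp_smul (ht.differentiableAt one_ne_zero)).deriv
  rw [h1.deriv_eq, (HasDerivAt.clm_const (hasDerivAt_comp_smul hX') u).deriv, one_smul]

theorem ExpIsDiffeoOn.exists_isNormalParam {F : M → Space} (hF : IsSmoothImmersion F) {o : M}
    {r : ℝ} (hr : 0 < r) (h : ExpIsDiffeoOn F o r) :
    ∃ E : OpenPartialHomeomorph Plane M, E.source = Metric.ball 0 r ∧ E 0 = o ∧
      IsSmoothParam E ∧ IsNormalParam (F ∘ E) r := by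
  obtain ⟨e, ⟨he0, hexp⟩, hsm, hinj, hbij⟩ := h
  obtain ⟨L, hL⟩ := exists_linear_isometry_param (differential F o) (hF.injective_differential o)
  have hmem : ∀ u, L u ∈ tangentDisk F o r ↔ u ∈ Metric.ball (0 : Plane) r := fun u => by
    rw [mem_ball_zero_iff, ← hL u]; rfl
  have hLs : ContMDiff (𝓡 2) (𝓡 2) ∞ L := L.contDiff.contMDiff
  have hdisk : IsOpen (tangentDisk F o r) :=
    isOpen_lt (differential F o).continuous.norm continuous_const
  obtain ⟨E, hEs, hEe, hE⟩ := exists_isSmoothParam (e := e ∘ L) Metric.isOpen_ball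
    (hsm.comp hLs.contMDiffOn fun u hu => (hmem u).2 hu)
    (hinj.comp L.injective.injOn fun u hu => (hmem u).2 hu) (by
      intro u hu
      rw [mfderiv_comp u ((hsm.contMDiffAt
        (hdisk.mem_nhds ((hmem u).2 hu))).mdifferentiableAt (by simp))
        (hLs.contMDiffAt.mdifferentiableAt (by simp)), mfderiv_eq_fderiv]
      refine (hbij _ ((hmem u).2 hu)).1.comp ?_
      rw [L.fderiv]
      exact L.injective)
  have hE0 : E 0 = o := by rw [hEe, Function.comp_apply, map_zero, he0]
  have h0 : (0 : Plane) ∈ E.source := by rw [hEs]; exact Metric.mem_ball_self hr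
  have hXs := contDiffOn_comp_param hF hE
  have hXat : ∀ u ∈ E.source, ContDiffAt ℝ ∞ (F ∘ E) u := fun u hu =>
    hXs.contDiffAt (E.open_source.mem_nhds hu)
  have hcurve : ∀ u : Plane, (fun t : ℝ => (F ∘ E) (t • u)) = F ∘ fun t : ℝ => e (t • L u) := by
    intro u
    ext1 t
    rw [hEe]; simp
  refine ⟨E, hEs, hE0, hE, hEs ▸ hXs, fun u hu => injective_fderiv_comp_param hF hE (hEs ▸ hu),
    ?_, ?_⟩
  -- The initial velocity of the exponential map is prescribed only for vectors in the disk;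
  -- homogeneity extends the isometry to all `v`.
  · have hsmall : ∀ v ∈ Metric.ball (0 : Plane) r, ‖fderiv ℝ (F ∘ E) 0 v‖ = ‖v‖ := by
      intro v hv
      have h1 := (hexp (L v) ((hmem v).2 hv)).1
      have h2 : HasMFDerivAt (𝓡 2) 𝓘(ℝ, Space) F (e ((0 : ℝ) • L v)) (differential F o) := by
        have h3 : e ((0 : ℝ) • L v) = o := by rw [zero_smul, he0]
        have h4 := (hF.contMDiff.contMDiffAt (x := e ((0 : ℝ) • L v))).mdifferentiableAt
          (by simp) |>.hasMFDerivAt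
        have h5 : differential F (e ((0 : ℝ) • L v)) = differential F o := by rw [h3]
        rw [← h5]; exact h4
      have h3 : HasFDerivAt (F ∘ fun t : ℝ => e (t • L v)) ((differential F o).comp
          (ContinuousLinearMap.toSpanSingleton ℝ (L v))) 0 :=
        (HasMFDerivAt.comp (0 : ℝ) h2 h1).hasFDerivAt
      rw [← hcurve v] at h3
      have h4 := h3.hasDerivAt.unique
        (hasDerivAt_comp_smul (v := v) (t := 0) (by
          rw [zero_smul]; exact (hXat 0 h0).differentiableAt (by simp)))
      rw [zero_smul] at h4
      rw [← h4, ← hL v]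
      congr 1
      change differential F o ((1 : ℝ) • L v) = _
      rw [one_smul]
    intro v
    by_cases hv : v = 0
    · simp [hv]
    have hv' : 0 < ‖v‖ := norm_pos_iff.2 hv
    have h1 := hsmall ((r / 2 / ‖v‖) • v) (by
      rw [mem_ball_zero_iff, norm_smul, Real.norm_eq_abs, abs_of_pos (by positivity),
        div_mul_cancel₀ _ hv'.ne']
      linarith)
    rw [map_smul, norm_smul, norm_smul] at h1
    exact mul_left_cancel₀ (norm_ne_zero_iff.2 (by positivity)) h1
  · intro u hu w
    have huE : u ∈ E.source := hEs ▸ hu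
    -- At time `1` the radial geodesic passes through `u` with acceleration `D²X_u(u, u)`.
    have h1 := (hexp (L u) ((hmem u).2 hu)).2.2 1 (by simpa using (hmem u).2 hu)
      (mfderiv (𝓡 2) (𝓡 2) E u w)
    rw [← hcurve u, deriv_deriv_comp_smul (hXat u huE)] at h1
    rw [fderiv_comp_param hF hE huE]
    have h2 : e ((1 : ℝ) • L u) = E u := by rw [hEe]; simp
    have h3 : differential F (e ((1 : ℝ) • L u)) = differential F (E u) := by rw [h2]
    rw [← h3]
    exact h1

end

end ImmersedSurface

namespace ImmersedSurface

noncomputable section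

variable {M : Type*} [TopologicalSpace M] [ChartedSpace Plane M]

/-! ### Lengths of curves -/

theorem IsNormalParam.norm_fderiv_smul_self {X : Plane → Space} {r : ℝ} (hX : IsNormalParam X r)
    {u : Plane} {t : ℝ} (hu : t • u ∈ Metric.ball (0 : Plane) r) :
    ‖fderiv ℝ X (t • u) u‖ = ‖u‖ := by
  by_cases ht : t = 0
  · rw [ht, zero_smul, hX.norm_zero]
  have h := hX.inner_fderiv_self hu
  rw [real_inner_self_eq_norm_sq, real_inner_self_eq_norm_sq, map_smul, norm_smul, norm_smul,
    pow_left_inj₀ (by positivity) (by positivity) two_ne_zero] at h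
  exact mul_left_cancel₀ (norm_ne_zero_iff.2 ht) h

theorem differential_mfderiv {F : M → Space} (hF : IsSmoothImmersion F) {γ : ℝ → M} {t : ℝ}
    (hγ : MDifferentiableAt 𝓘(ℝ, ℝ) (𝓡 2) γ t) :
    differential F (γ t) (mfderiv 𝓘(ℝ, ℝ) (𝓡 2) γ t (1 : ℝ)) = deriv (F ∘ γ) t := by
  have h : HasFDerivAt (F ∘ γ)
      ((differential F (γ t)).comp (mfderiv 𝓘(ℝ, ℝ) (𝓡 2) γ t)) t :=
    (HasMFDerivAt.comp t (hF.contMDiff.contMDiffAt.mdifferentiableAt (by simp)).hasMFDerivAt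
      hγ.hasMFDerivAt).hasFDerivAt
  exact h.hasDerivAt.deriv.symm

theorem intrinsicDist_le {F : M → Space} {γ : ℝ → M} {a b : ℝ} (hab : a ≤ b)
    (hγ : ContMDiffOn 𝓘(ℝ, ℝ) (𝓡 2) 1 γ (Icc a b)) :
    intrinsicDist F (γ a) (γ b) ≤ ∫⁻ t in Ioo a b,
      ENNReal.ofReal ‖differential F (γ t) (mfderiv 𝓘(ℝ, ℝ) (𝓡 2) γ t (1 : ℝ))‖ := by
  let _ : ∀ z : M, ENorm (TangentSpace (𝓡 2) z) :=
    fun z => ⟨fun v => ENNReal.ofReal (tangentNorm F z v)⟩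
  have : ∀ z : M, ENormSMulClass ℝ (TangentSpace (𝓡 2) z) := fun z => by
    have h : ∀ (c : ℝ) (v : Plane), ENNReal.ofReal ‖differential F z (c • v)‖ =
        ‖c‖ₑ * ENNReal.ofReal ‖differential F z v‖ := fun c v => by
      rw [map_smul, norm_smul, ENNReal.ofReal_mul (norm_nonneg _), ofReal_norm]
    exact ⟨h⟩
  have h := Manifold.riemannianEDist_le_pathELength (I := 𝓡 2) hγ rfl rfl hab
  rw [Manifold.pathELength_eq_lintegral_mfderiv_Ioo] at h
  exact h

theorem exists_path_of_intrinsicDist_lt {F : M → Space} {x y : M} {ρ : ℝ≥0∞}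
    (h : intrinsicDist F x y < ρ) :
    ∃ γ : ℝ → M, γ 0 = x ∧ γ 1 = y ∧ ContMDiffOn 𝓘(ℝ, ℝ) (𝓡 2) 1 γ (Icc 0 1) ∧
      ∫⁻ t in Ioo (0 : ℝ) 1,
        ENNReal.ofReal ‖differential F (γ t) (mfderiv 𝓘(ℝ, ℝ) (𝓡 2) γ t (1 : ℝ))‖ < ρ := by
  let _ : ∀ z : M, ENorm (TangentSpace (𝓡 2) z) :=
    fun z => ⟨fun v => ENNReal.ofReal (tangentNorm F z v)⟩
  obtain ⟨γ, h0, h1, hγ, hl⟩ := Manifold.exists_lt_of_riemannianEDist_lt (I := 𝓡 2) h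
  rw [Manifold.pathELength_eq_lintegral_mfderiv_Ioo] at hl
  exact ⟨γ, h0, h1, hγ, hl⟩

/-! ### Intrinsic balls -/

variable [IsManifold (𝓡 2) ∞ M] {F : M → Space} (hF : IsSmoothImmersion F)
  {E : OpenPartialHomeomorph Plane M} (hE : IsSmoothParam E) {r : ℝ}
  (hEr : E.source = Metric.ball 0 r) (hX : IsNormalParam (F ∘ E) r)
include hF hE hEr hX

omit [IsManifold (𝓡 2) ∞ M] in
-- The radial path to `E u` has constant speed `‖u‖`, hence length `‖u‖ < ρ`.
theorem image_ball_subset_intrinsicBall {ρ : ℝ} (hρr : ρ ≤ r) :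
    E '' Metric.ball 0 ρ ⊆ intrinsicBall F (E 0) ρ := by
  rintro _ ⟨u, hu, rfl⟩
  have hball : ∀ t ∈ Icc (0 : ℝ) 1, t • u ∈ Metric.ball (0 : Plane) r := fun t ht =>
    IsNormalParam.smul_mem_ball (Metric.ball_subset_ball hρr hu) ht
  have hat : ∀ t ∈ Icc (0 : ℝ) 1,
      ContMDiffAt 𝓘(ℝ, ℝ) (𝓡 2) ∞ (fun t : ℝ => E (t • u)) t := fun t ht => by
    have h1 : ContMDiffAt 𝓘(ℝ, ℝ) (𝓡 2) ∞ (fun t : ℝ => t • u) t :=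
      (contDiff_id.smul contDiff_const).contMDiff.contMDiffAt
    exact (hE.contMDiffOn.contMDiffAt (E.open_source.mem_nhds (hEr ▸ hball t ht))).comp t h1
  have h := intrinsicDist_le (F := F) zero_le_one (γ := fun t : ℝ => E (t • u)) fun t ht =>
    ((hat t ht).of_le (by norm_cast)).contMDiffWithinAt
  simp only [zero_smul, one_smul] at h
  refine h.trans_lt ?_
  rw [setLIntegral_congr_fun (g := fun _ => ENNReal.ofReal ‖u‖) measurableSet_Ioo fun t ht => ?_]
  · simp only [lintegral_const, Measure.restrict_apply_univ, Real.volume_Ioo, sub_zero,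
      ENNReal.ofReal_one, mul_one]
    rw [mem_ball_zero_iff] at hu
    exact (ENNReal.ofReal_lt_ofReal_iff ((norm_nonneg u).trans_lt hu)).2 hu
  · have ht' := Ioo_subset_Icc_self ht
    have h1 := differential_mfderiv hF ((hat t ht').mdifferentiableAt (by simp))
    have h2 := hX.norm_fderiv_smul_self (hball t ht')
    have h3 := (hasDerivAt_comp_smul
      ((hX.contDiffAt (hball t ht')).differentiableAt (by simp))).deriv
    have h4 : deriv (F ∘ fun t : ℝ => E (t • u)) t = fderiv ℝ (F ∘ E) (t • u) u := h3
    change ENNReal.ofReal ‖differential F (E (t • u)) _‖ = _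
    rw [h1, h4, h2]

/-- The radial distance does not grow faster than the length of a curve. -/
theorem sqrt_sub_le_length {γ : ℝ → M} {b δ : ℝ} (hb : 0 ≤ b) (hδ : 0 < δ)
    (hγ : ContMDiffOn 𝓘(ℝ, ℝ) (𝓡 2) 1 γ (Icc 0 b)) (hmem : ∀ t ∈ Icc 0 b, γ t ∈ E.target)
    (h0 : γ 0 = E 0) (hr : 0 < r) :
    ENNReal.ofReal (Real.sqrt (‖E.symm (γ b)‖ ^ 2 + δ ^ 2) - δ) ≤ ∫⁻ t in Ioo 0 b,
      ENNReal.ofReal ‖differential F (γ t) (mfderiv 𝓘(ℝ, ℝ) (𝓡 2) γ t (1 : ℝ))‖ := by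
  set c : ℝ → Plane := fun t => E.symm (γ t) with hc
  have hcd : ContDiffOn ℝ 1 c (Icc 0 b) := by
    rw [← contMDiffOn_iff_contDiffOn]
    exact ((contMDiffOn_param_symm hE).of_le (by norm_cast)).comp hγ hmem
  have hpos : ∀ t, 0 < ‖c t‖ ^ 2 + δ ^ 2 := fun t => by positivity
  -- The norm is not differentiable at the origin, where the path starts; `√(|c|² + δ²)` is a smooth
  -- substitute with a derivative no larger than the speed.
  have hf : ContDiffOn ℝ 1 (fun t => Real.sqrt (‖c t‖ ^ 2 + δ ^ 2)) (Icc 0 b) :=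
    ((hcd.norm_sq ℝ).add contDiffOn_const).sqrt fun t _ => (hpos t).ne'
  have h1 := enorm_sub_le_lintegral_deriv_of_contDiffOn_Icc hf hb
  have hc0 : c 0 = 0 := by
    simp only [hc]
    rw [h0, E.left_inv (by rw [hEr]; exact Metric.mem_ball_self hr)]
  rw [hc0, norm_zero, zero_pow two_ne_zero, zero_add, Real.sqrt_sq hδ.le] at h1
  refine (Real.ofReal_le_enorm _).trans (h1.trans ?_)
  rw [← restrict_Ioo_eq_restrict_Icc]
  refine setLIntegral_mono' measurableSet_Ioo fun t ht => ?_
  have ht' := Ioo_subset_Icc_self ht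
  have hcs : c t ∈ Metric.ball (0 : Plane) r := hEr ▸ E.map_target (hmem t ht')
  have hct : DifferentiableAt ℝ c t :=
    (hcd.contDiffAt (Icc_mem_nhds ht.1 ht.2)).differentiableAt one_ne_zero
  have hγt : MDifferentiableAt 𝓘(ℝ, ℝ) (𝓡 2) γ t :=
    (hγ.contMDiffAt (Icc_mem_nhds ht.1 ht.2)).mdifferentiableAt one_ne_zero
  have e1 : deriv (F ∘ γ) t = fderiv ℝ (F ∘ E) (c t) (deriv c t) := by
    have h2 : F ∘ γ =ᶠ[nhds t] (F ∘ E) ∘ c := by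
      filter_upwards [Icc_mem_nhds ht.1 ht.2] with s hs
      simp only [Function.comp_apply, hc]
      rw [E.right_inv (hmem s hs)]
    rw [h2.deriv_eq]
    exact (((hX.contDiffAt hcs).differentiableAt (by simp)).hasFDerivAt.comp_hasDerivAt t
      hct.hasDerivAt).deriv
  rw [differential_mfderiv hF hγt, e1]
  have e2 : HasDerivAt (fun t => Real.sqrt (‖c t‖ ^ 2 + δ ^ 2))
      (2 * ⟪c t, deriv c t⟫_ℝ / (2 * Real.sqrt (‖c t‖ ^ 2 + δ ^ 2))) t :=
    (hct.hasDerivAt.norm_sq.add_const _).sqrt (hpos t).ne'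
  rw [e2.deriv, Real.enorm_eq_ofReal_abs]
  refine ENNReal.ofReal_le_ofReal ?_
  rw [mul_div_mul_left _ _ two_ne_zero, abs_div, abs_of_pos (Real.sqrt_pos.2 (hpos t)),
    div_le_iff₀ (Real.sqrt_pos.2 (hpos t)), mul_comm]
  refine (hX.abs_inner_le hcs _).trans ?_
  gcongr
  exact Real.le_sqrt_of_sq_le (by nlinarith [sq_nonneg δ])

/-- A path from the centre to a point outside must leave the image of each smaller disk; up to its
first exit from the disk of radius `ρ₀` its length is already almost `ρ₀`. -/
theorem intrinsicBall_subset_image_ball [T2Space M] {ρ : ℝ} (hρ : 0 < ρ) (hρr : ρ ≤ r) :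
    intrinsicBall F (E 0) ρ ⊆ E '' Metric.ball 0 ρ := by
  intro x hx
  obtain ⟨γ, h0, h1, hγ, hl⟩ := exists_path_of_intrinsicDist_lt hx
  -- Radii with length `< ρ₁ < ρ₀ < ρ`: the gap `ρ₀ - ρ₁` will serve as the smoothing parameter `δ`.
  obtain ⟨ρ₁, hρ₁, hl₁, hρ₁ρ⟩ : ∃ ρ₁ : ℝ, 0 ≤ ρ₁ ∧ _ < ENNReal.ofReal ρ₁ ∧ ρ₁ < ρ := by
    obtain ⟨y, hy1, hy2⟩ := ENNReal.lt_iff_exists_nnreal_btwn.1 hl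
    exact ⟨y, y.2, by rwa [ENNReal.ofReal_coe_nnreal],
      by rwa [← ENNReal.ofReal_coe_nnreal, ENNReal.ofReal_lt_ofReal_iff hρ] at hy2⟩
  obtain ⟨ρ₀, hρ₁₀, hρ₀⟩ := exists_between hρ₁ρ
  have hρ₀0 : 0 < ρ₀ := hρ₁.trans_lt hρ₁₀
  have hr : 0 < r := hρ.trans_le hρr
  by_contra hxB
  have hclosed : Metric.closedBall (0 : Plane) ρ₀ ⊆ E.source := by
    rw [hEr]; exact Metric.closedBall_subset_ball (hρ₀.trans_le hρr)
  set B := E '' Metric.ball 0 ρ₀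
  have hB : IsOpen B := E.isOpen_image_of_subset_source Metric.isOpen_ball
    (Metric.ball_subset_closedBall.trans hclosed)
  -- In a Hausdorff surface the compact image is closed, so the exit point still lies in the
  -- parametrized region.
  have hK : IsClosed (E '' Metric.closedBall (0 : Plane) ρ₀) :=
    ((isCompact_closedBall 0 ρ₀).image_of_continuousOn (E.continuousOn.mono hclosed)).isClosed
  set T := Icc (0 : ℝ) 1 ∩ γ ⁻¹' Bᶜ
  have hT : IsClosed T := hγ.continuousOn.preimage_isClosed_of_isClosed isClosed_Icc hB.isClosed_compl
  have h1T : (1 : ℝ) ∈ T := by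
    refine ⟨⟨zero_le_one, le_rfl⟩, fun h => hxB ?_⟩
    rw [h1] at h
    exact image_mono (Metric.ball_subset_ball hρ₀.le) h
  have hbdd : BddBelow T := ⟨0, fun t ht => ht.1.1⟩
  have hτ := hT.csInf_mem ⟨1, h1T⟩ hbdd
  set τ := sInf T
  have hlt : ∀ t ∈ Ico 0 τ, γ t ∈ B := fun t ht => by
    by_contra h
    exact absurd (csInf_le hbdd (show t ∈ T from ⟨⟨ht.1, ht.2.le.trans hτ.1.2⟩, h⟩))
      (not_le.2 ht.2)
  have hτ0 : 0 < τ := by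
    refine lt_of_le_of_ne hτ.1.1 fun h => hτ.2 ?_
    rw [← h, h0]
    exact mem_image_of_mem E (Metric.mem_ball_self hρ₀0)
  have hτK : γ τ ∈ E '' Metric.closedBall (0 : Plane) ρ₀ := by
    have hcont : ContinuousWithinAt γ (Ico 0 τ) τ :=
      (hγ.continuousOn τ hτ.1).mono fun t ht => ⟨ht.1, ht.2.le.trans hτ.1.2⟩
    refine hK.closure_subset_iff.2 (image_mono Metric.ball_subset_closedBall)
      (hcont.mem_closure ?_ hlt)
    rw [closure_Ico hτ0.ne]
    exact right_mem_Icc.2 hτ0.le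
  have hmem : ∀ t ∈ Icc 0 τ, γ t ∈ E.target := fun t ht => by
    have h : γ t ∈ E '' Metric.closedBall (0 : Plane) ρ₀ := by
      rcases ht.2.lt_or_eq with h | h
      · exact image_mono Metric.ball_subset_closedBall (hlt t ⟨ht.1, h⟩)
      · rw [h]; exact hτK
    obtain ⟨v, hv, hvt⟩ := h
    rw [← hvt]
    exact E.map_source (hclosed hv)
  obtain ⟨v, hv, hvτ⟩ := hτK
  have hvρ : ρ₀ ≤ ‖E.symm (γ τ)‖ := by
    rw [← hvτ, E.left_inv (hclosed hv)]
    by_contra h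
    exact hτ.2 (hvτ ▸ mem_image_of_mem E (mem_ball_zero_iff.2 (not_le.1 h)))
  have hlen := sqrt_sub_le_length hF hE hEr hX hτ0.le (sub_pos.2 hρ₁₀)
    (hγ.mono (Icc_subset_Icc le_rfl hτ.1.2)) hmem h0 hr
  have h2 : ρ₁ ≤ Real.sqrt (‖E.symm (γ τ)‖ ^ 2 + (ρ₀ - ρ₁) ^ 2) - (ρ₀ - ρ₁) := by
    have : ρ₀ ≤ Real.sqrt (‖E.symm (γ τ)‖ ^ 2 + (ρ₀ - ρ₁) ^ 2) :=
      Real.le_sqrt_of_sq_le (by nlinarith [sq_nonneg (ρ₀ - ρ₁)])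
    linarith
  exact absurd hl₁ (not_lt.2 ((ENNReal.ofReal_le_ofReal h2).trans (hlen.trans
    (lintegral_mono_set (Ioo_subset_Ioo le_rfl hτ.1.2)))))

/-! ### The area of intrinsic balls -/

theorem area_intrinsicBall_le_of_param [T2Space M] [SecondCountableTopology M]
    [MeasurableSpace M] [BorelSpace M] {ρ : ℝ} (hρ : 0 < ρ) (hρr : ρ < r) :
    area F (intrinsicBall F (E 0) ρ) ≤ ENNReal.ofReal (ρ ^ 2) * (ENNReal.ofReal Real.pi +
      1 / 2 * ∫⁻ x in intrinsicBall F (E 0) ρ,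
        ENNReal.ofReal (secondFormNormSq F x) ∂(area F)) := by
  have hsub : Metric.ball (0 : Plane) ρ ⊆ E.source := by
    rw [hEr]; exact Metric.ball_subset_ball hρr.le
  have himg : intrinsicBall F (E 0) ρ = E '' Metric.ball 0 ρ :=
    (intrinsicBall_subset_image_ball hF hE hEr hX hρ hρr.le).antisymm
      (image_ball_subset_intrinsicBall hF hE hEr hX hρr.le)
  have hmeas : MeasurableSet (E '' Metric.ball (0 : Plane) ρ) :=
    (E.isOpen_image_of_subset_source Metric.isOpen_ball hsub).measurableSet
  have hXs := contDiffOn_comp_param hF hE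
  have harea := setLIntegral_area_image hF hE Metric.isOpen_ball hsub
    (h := fun _ => 1) continuousOn_const
  have hcurv := setLIntegral_area_image hF hE Metric.isOpen_ball hsub
    (h := fun u => ENNReal.ofReal (-gaussCurvature (F ∘ E) u))
    (ENNReal.continuous_ofReal.comp_continuousOn (continuousOn_gaussCurvature E.open_source hXs
      fun u hu => normalVector_comp_param_ne_zero hF hE hu).neg)
  simp only [lintegral_const, Measure.restrict_apply_univ, one_mul] at harea
  rw [himg, harea]
  refine (hX.lintegral_ball_le hρ hρr).trans ?_
  gcongr
  simp only [ENNReal.ofReal_mul' (norm_nonneg _)]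
  rw [← hcurv]
  refine setLIntegral_mono' hmeas ?_
  rintro _ ⟨u, hu, rfl⟩
  rw [E.left_inv (hsub hu)]
  exact neg_gaussCurvature_le hF hE (hsub hu)

omit hE hEr hX in
-- The injectivity radius is a supremum, so an exponential diffeomorphism is only available on disks
-- slightly larger than a given `ρ < s`. The estimate is proved for such `ρ` and passes to the
-- increasing union of balls.
theorem area_intrinsicBall_le [T2Space M] [SecondCountableTopology M] [MeasurableSpace M]
    [BorelSpace M] (o : M) {s : ℝ} (hs : 0 < s) (hinj : ENNReal.ofReal s ≤ injRadius F o) :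
    area F (intrinsicBall F o s) ≤ ENNReal.ofReal (s ^ 2) * (ENNReal.ofReal Real.pi +
      1 / 2 * ∫⁻ x in intrinsicBall F o s,
        ENNReal.ofReal (secondFormNormSq F x) ∂(area F)) := by
  obtain ⟨a, ha, ha2, halim⟩ := exists_seq_strictMono_tendsto' hs
  have hmono : ∀ {ρ ρ' : ℝ}, ρ ≤ ρ' → intrinsicBall F o ρ ⊆ intrinsicBall F o ρ' :=
    fun h x hx => lt_of_lt_of_le hx (ENNReal.ofReal_le_ofReal h)
  have hU : intrinsicBall F o s = ⋃ n, intrinsicBall F o (a n) := by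
    refine Subset.antisymm (fun x hx => ?_) (iUnion_subset fun n => hmono (ha2 n).2.le)
    have h1 : Filter.Tendsto (fun n => ENNReal.ofReal (a n)) Filter.atTop
        (nhds (ENNReal.ofReal s)) := (ENNReal.continuous_ofReal.tendsto s).comp halim
    obtain ⟨n, hn⟩ := (h1.eventually (lt_mem_nhds hx)).exists
    exact mem_iUnion.2 ⟨n, hn⟩
  have hdir : Monotone fun n => intrinsicBall F o (a n) := fun m n h => hmono (ha.monotone h)
  rw [hU, hdir.measure_iUnion, ← hU]
  refine iSup_le fun n => ?_
  have hlt : ENNReal.ofReal (a n) < injRadius F o :=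
    lt_of_lt_of_le ((ENNReal.ofReal_lt_ofReal_iff hs).2 (ha2 n).2) hinj
  unfold injRadius at hlt
  obtain ⟨r, hr⟩ := lt_iSup_iff.1 hlt
  obtain ⟨hexp, hr⟩ := lt_iSup_iff.1 hr
  have hrn : a n < r := by
    rw [← ENNReal.ofReal_coe_nnreal] at hr
    exact (ENNReal.ofReal_lt_ofReal_iff_of_nonneg (ha2 n).1.le).1 hr
  obtain ⟨E, hEs, hE0, hE, hX⟩ := hexp.exists_isNormalParam hF ((ha2 n).1.trans hrn)
  have h := area_intrinsicBall_le_of_param hF hE hEs hX (ha2 n).1 hrn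
  rw [hE0] at h
  refine h.trans ?_
  have hn0 := (ha2 n).1
  have hns := (ha2 n).2
  gcongr
  exact hmono hns.le

end

end ImmersedSurface

/-! ### Conclusion: Hölder combined with the area estimate -/

theorem mainTheorem6 {M : Type*} [TopologicalSpace M] [T2Space M] [SecondCountableTopology M]
    [ChartedSpace (EuclideanSpace ℝ (Fin 2)) M] [IsManifold (𝓡 2) ∞ M]
    [MeasurableSpace M] [BorelSpace M]
    (F : M → EuclideanSpace ℝ (Fin 3)) (hF : ImmersedSurface.IsSmoothImmersion F)
    (o : M) (ho : F o = 0) (s : ℝ) (hs : 0 < s)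
    (hinj : ENNReal.ofReal s ≤ ImmersedSurface.injRadius F o)
    (p q : ℝ) (hp : 2 < p) (hpq : 1 / q + 2 / p = 1) (ε : ℝ≥0∞)
    (hε : (ENNReal.ofReal s ^ (p - 2) *
        ∫⁻ x in ImmersedSurface.intrinsicBall F o s,
          ENNReal.ofReal |ImmersedSurface.meanCurvature F x| ^ p ∂(ImmersedSurface.area F))
        ^ (1 / p) = ε) :
    (∫⁻ x in ImmersedSurface.intrinsicBall F o s,
        ENNReal.ofReal |ImmersedSurface.meanCurvature F x| ^ 2 ∂(ImmersedSurface.area F)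
      ≤ ε ^ 2 * (ENNReal.ofReal (s ^ (-2 : ℤ)) *
          ImmersedSurface.area F (ImmersedSurface.intrinsicBall F o s)) ^ (1 / q)) ∧
    (∫⁻ x in ImmersedSurface.intrinsicBall F o s,
        ENNReal.ofReal |ImmersedSurface.meanCurvature F x| ^ 2 ∂(ImmersedSurface.area F)
      ≤ ENNReal.ofReal ((2 : ℝ) ^ (p / 2)) * (ε ^ 2 + ε ^ p) *
          (ENNReal.ofReal Real.pi + (1 / 2) *
            ∫⁻ x in ImmersedSurface.intrinsicBall F o s,
              ENNReal.ofReal (ImmersedSurface.secondFormNormSq F x)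
                ∂(ImmersedSurface.area F)) ^ (1 / q)) := by
  have hL2 := lintegral_sq_le_of_measure_le
    ((ImmersedSurface.area F).restrict (ImmersedSurface.intrinsicBall F o s))
    (fun x => ENNReal.ofReal |ImmersedSurface.meanCurvature F x|) hs hp hpq hε
  rw [Measure.restrict_apply_univ] at hL2
  exact ⟨hL2.1, hL2.2 _ (ImmersedSurface.area_intrinsicBall_le hF o hs hinj)⟩
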